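/- Let $X/\mathbb{F}_q$ be a smooth projective geometrically connected curve of genus $g$ over the field with $q$ elements, let $W$ be an algebraically closed field containing $\mathbb{F}_q$, and let $\overline{X}=X_W$ be the base change of $X$ to $W$. A divisor of $X$ and its base change to $\overline{X}$ are denoted by the same letter. For $n\in\mathbb{Z}$, let $f\mapsto f^{(n)}$ be the automorphism of the function field of $\overline{X}$ that is $c\mapsto c^{q^n}$ on $W$ and the identity on $\mathbb{F}_q(X)$; let $\xi\mapsto\xi^{(n)}$ be the action of the $q^n$-th power automorphism of $W$ on the points $\overline{X}=X(W)$, and $E\mapsto E^{(n)}$ its additive extension to divisors of $\overline{X}$. For an effective divisor $D$ of $X$ and divisors $E_1,E_2$ of $\overline{X}$ supported away from $D$, write $E_1\sim_D E_2$ if $E_1-E_2=(f)$ for a nonzero meromorphic function $f$ on $\overline{X}$ that is regular near $D$ and whose restriction to the closed subscheme $D$ is identically $1$. A (rank-one) shtuka is a quadruple $(D,\xi,\eta,E)$ in which $D$ is a nonzero effective divisor of $X$; $\xi,\eta\in\overline{X}\setminus\operatorname{supp}D$; $E$ is a divisor of $\overline{X}$ supported away from $D$; $E-E^{(1)}\sim_D-\xi^{(1)}+\eta$;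 and $\deg E=g-1$. It is nondegenerate if $\eta\neq\xi^{(i)}$ for every integer $i$ with $1-\deg(E+D)\le i\le g$. Put $$\Psi(D,\xi,\eta,E)=\{\psi\in H^0(\overline{X},\mathcal{O}_{\overline{X}}(E+D)) : \psi-\psi^{(1)}\text{ is regular in some neighborhood of }D\},$$ a vector space over $\mathbb{F}_q$. **Theorem.** Let $(D,\xi,\eta,E)$ be a nondegenerate shtuka. Then: 1. $h^0(\mathcal{O}_{\overline{X}}(E))=h^1(\mathcal{O}_{\overline{X}}(E))=0$. 2. $\Psi(D,\xi,\eta,E)\otimes_{\mathbb{F}_q}W=H^0(\mathcal{O}_{\overline{X}}(E+D))$; that is, the natural map $\psi\otimes w\mapsto w\psi$ from the left side to the function field of $\overline{X}$ is injective with image the right side. 3. $\Psi(D,\xi,\eta,E)\cap H^0(\mathcal{O}_{\overline{X}}(E+D-\xi))=\{0\}$. -/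

import Mathlib

open scoped TensorProduct

noncomputable section

/-! ## Smooth projective curves through their function fields

A smooth projective integral curve over a field `F` is given by its function field `L`, a finitely
generated extension of `F` of transcendence degree one.  The closed points of the curve are the
normalized discrete valuations of `L` that are trivial on `F`. -/

/-- A closed point of the curve with function field `L` over `F`: the order function
`ord : L → ℤ ∪ {∞}` of a discrete valuation with value group `ℤ`, trivial on the constants. -/
structure Place (F L : Type*) [Field F] [Field L] [Algebra F L] where
  ord : AddValuation L (WithTop ℤ)
  ord_const : ∀ c : F, c ≠ 0 → ord (algebraMap F L c) = 0
  exists_uniformizer : ∃ t : L, ord t = 1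

/-- Divisors: the free abelian group on the closed points. -/
abbrev Divisor (F L : Type*) [Field F] [Field L] [Algebra F L] : Type _ := Place F L →₀ ℤ

namespace Place

variable {F L : Type*} [Field F] [Field L] [Algebra F L]

theorem zero_le_ord_const (x : Place F L) (c : F) : 0 ≤ x.ord (algebraMap F L c) := by
  by_cases h : c = 0
  · simp [h]
  · exact (x.ord_const c h).ge

theorem le_ord_smul (x : Place F L) (c : F) {f : L} {n : WithTop ℤ} (h : n ≤ x.ord f) :
    n ≤ x.ord (c • f) := by
  rw [Algebra.smul_def, x.ord.map_mul]
  exact h.trans (le_add_of_nonneg_left (x.zero_le_ord_const c))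

end Place

section Curve

variable {F L : Type*} [Field F] [Field L] [Algebra F L]

/-- The space `H⁰(O(E))` of functions `f` with `(f) + E ≥ 0` (together with `f = 0`). -/
def H0 (E : Place F L → ℤ) : Submodule F L where
  carrier := {f | ∀ x : Place F L, ((-E x : ℤ) : WithTop ℤ) ≤ x.ord f}
  zero_mem' := fun x => by simp
  add_mem' := fun ha hb x => x.ord.map_le_add (ha x) (hb x)
  smul_mem' := fun c _ hf x => x.le_ord_smul c (hf x)

/-- Repartitions (adeles before completion): families `(r_x)` of functions indexed by the closed
points, such that `r_x` is regular at `x` for all but finitely many `x`. -/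
def repartitions (F L : Type*) [Field F] [Field L] [Algebra F L] :
    Submodule F (Place F L → L) where
  carrier := {r | {x : Place F L | ¬ 0 ≤ x.ord (r x)}.Finite}
  zero_mem' := by simp
  add_mem' := fun {r s} hr hs => (hr.union hs).subset fun x hx => by
    by_contra h
    simp only [Set.mem_union, Set.mem_ofPred_eq, not_or, not_not] at h hx
    exact hx (x.ord.map_le_add h.1 h.2)
  smul_mem' := fun c r hr => hr.subset fun x hx h => hx (x.le_ord_smul c h)

/-- The families `(r_x)` with `ord_x(r_x) ≥ -E(x)` for every closed point `x`. -/
def repartitionsLE (E : Divisor F L) : Submodule F (Place F L → L) where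
  carrier := {r | ∀ x : Place F L, ((-E x : ℤ) : WithTop ℤ) ≤ x.ord (r x)}
  zero_mem' := fun x => by simp
  add_mem' := fun ha hb x => x.ord.map_le_add (ha x) (hb x)
  smul_mem' := fun c _ hf x => x.le_ord_smul c (hf x)

/-- The functions, embedded diagonally as constant families. -/
def principalRepartitions (F L : Type*) [Field F] [Field L] [Algebra F L] :
    Submodule F (Place F L → L) :=
  LinearMap.range (LinearMap.pi fun _ : Place F L => (LinearMap.id : L →ₗ[F] L))

/-- `H¹(O(E)) = R / (R(E) + L)`, where `R` is the space of repartitions, `R(E)` the subspace of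
repartitions with poles bounded by `E`, and `L` the function field: the cokernel of
`L → ⨁ₓ L / O(E)ₓ`, i.e. the cohomology of the flasque resolution `L → L / O(E)` of `O(E)`. -/
abbrev H1 (E : Divisor F L) : Type _ :=
  repartitions F L ⧸
    (repartitionsLE E ⊔ principalRepartitions F L).submoduleOf (repartitions F L)

/-- `h⁰(O(E))`, the dimension of `H⁰(O(E))` as a cardinal number. -/
def h0 (E : Divisor F L) : Cardinal := Module.rank F (H0 (⇑E))

/-- `h¹(O(E))`, the dimension of `H¹(O(E))` as a cardinal number. -/
def h1 (E : Divisor F L) : Cardinal := Module.rank F (H1 E)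

/-- The genus `h¹(O)` of the curve with function field `L` over `F`. -/
def genus (F L : Type*) [Field F] [Field L] [Algebra F L] : ℕ :=
  Module.finrank F (H1 (0 : Divisor F L))

/-- The degree of a divisor, over an algebraically closed field of constants (where all closed
points have degree one). -/
def deg (E : Place F L → ℤ) : ℤ := ∑ᶠ x, E x

/-- `E₁ ∼_D E₂`: the divisor `E₁ - E₂` is `(f)` for a nonzero function `f` whose restriction to the
subscheme `D` is identically equal to one. -/
def EquivMod (D : Place F L → ℤ) (E₁ E₂ : Divisor F L) : Prop :=
  ∃ f : L, f ≠ 0 ∧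
    (∀ x : Place F L, x.ord f = (((E₁ - E₂) x : ℤ) : WithTop ℤ)) ∧
    (∀ x : Place F L, D x ≠ 0 → ((D x : ℤ) : WithTop ℤ) ≤ x.ord (f - 1))

end Curve

/-! ## Base change of a curve from a finite field to an algebraically closed field

Here `k` is the finite field with `q` elements, `K` is the function field of the curve `X` over `k`,
and `W` is an algebraically closed extension of `k`. -/

section BaseChange

/-- The function field of the curve `X_W`. -/
abbrev GeomFunctionField (k K W : Type*) [Field k] [Field K] [Algebra k K] [Field W]
    [Algebra k W] : Type _ :=
  FractionRing (W ⊗[k] K)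

variable {k K W : Type*} [Field k] [Field K] [Algebra k K] [Field W] [Algebra k W]

/-- Functions on `X` are functions on `X_W`. -/
def toGeom (k K W : Type*) [Field k] [Field K] [Algebra k K] [Field W] [Algebra k W] :
    K →ₐ[k] GeomFunctionField k K W :=
  (IsScalarTower.toAlgHom k (W ⊗[k] K) (GeomFunctionField k K W)).comp
    Algebra.TensorProduct.includeRight

/-- The automorphism of the function field of `X_W` that restricts to `σ` on `W` and to the identity
on the function field of `X`. -/
def conjFun (K : Type*) [Field K] [Algebra k K] (σ : W ≃ₐ[k] W) :
    GeomFunctionField k K W ≃ₐ[k] GeomFunctionField k K W :=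
  IsLocalization.algEquivOfAlgEquiv (A := k) (M := nonZeroDivisors (W ⊗[k] K))
    (T := nonZeroDivisors (W ⊗[k] K)) _ _
    (Algebra.TensorProduct.congr σ (AlgEquiv.refl : K ≃ₐ[k] K))
    (MulEquivClass.map_nonZeroDivisors _)

theorem conjFun_algebraMap (σ : W ≃ₐ[k] W) (c : W) :
    conjFun K σ (algebraMap W (GeomFunctionField k K W) c) =
      algebraMap W (GeomFunctionField k K W) (σ c) := by
  rw [IsScalarTower.algebraMap_apply W (W ⊗[k] K) (GeomFunctionField k K W),
    IsScalarTower.algebraMap_apply W (W ⊗[k] K) (GeomFunctionField k K W)]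
  exact (IsLocalization.algEquivOfAlgEquiv_eq _ _).trans (by simp)

theorem conjFun_toGeom (σ : W ≃ₐ[k] W) (f : K) :
    conjFun K σ (toGeom k K W f) = toGeom k K W f := by
  exact (IsLocalization.algEquivOfAlgEquiv_eq _ _).trans (by simp [toGeom])

/-- The `q`-th power automorphism of `W`. -/
def frob (k W : Type*) [Field k] [Fintype k] [Field W] [Algebra k W] [IsAlgClosed W] :
    W ≃ₐ[k] W :=
  AlgEquiv.ofBijective (FiniteField.frobeniusAlgHom k W)
    ⟨(FiniteField.frobeniusAlgHom k W).toRingHom.injective, fun c => by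
      obtain ⟨z, hz⟩ := IsAlgClosed.exists_pow_nat_eq c (Fintype.card_pos (α := k))
      exact ⟨z, hz⟩⟩

theorem frob_apply [Fintype k] [IsAlgClosed W] (c : W) : frob k W c = c ^ Fintype.card k := rfl

variable [IsDomain (W ⊗[k] K)]

/-- The closed point `σ(x)` of `X_W` obtained by applying the automorphism `σ` of `W` to the
coordinates of `x`: the order of `conjFun σ f` at `σ(x)` is the order of `f` at `x`. -/
def Place.conj (σ : W ≃ₐ[k] W) (x : Place W (GeomFunctionField k K W)) :
    Place W (GeomFunctionField k K W) where
  ord := x.ord.comap ((conjFun K σ).symm : GeomFunctionField k K W →+* GeomFunctionField k K W)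
  ord_const := fun c hc => by
    have h : (conjFun K σ).symm (algebraMap W (GeomFunctionField k K W) c) =
        algebraMap W (GeomFunctionField k K W) (σ.symm c) := by
      rw [AlgEquiv.symm_apply_eq, conjFun_algebraMap, AlgEquiv.apply_symm_apply]
    change x.ord ((conjFun K σ).symm (algebraMap W (GeomFunctionField k K W) c)) = 0
    rw [h]
    exact x.ord_const _ (by simpa using hc)
  exists_uniformizer := by
    obtain ⟨t, ht⟩ := x.exists_uniformizer
    refine ⟨conjFun K σ t, ?_⟩
    change x.ord ((conjFun K σ).symm (conjFun K σ t)) = 1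
    rw [AlgEquiv.symm_apply_apply, ht]

theorem Place.conj_ord_conjFun (σ : W ≃ₐ[k] W) (x : Place W (GeomFunctionField k K W))
    (f : GeomFunctionField k K W) : (x.conj σ).ord (conjFun K σ f) = x.ord f := by
  change x.ord ((conjFun K σ).symm (conjFun K σ f)) = _
  rw [AlgEquiv.symm_apply_apply]

section Twist

variable [Fintype k] [IsAlgClosed W]

/-- The `n`-fold twist `f⁽ⁿ⁾` of a function `f` on `X_W`. -/
def twistFun (n : ℤ) (f : GeomFunctionField k K W) : GeomFunctionField k K W :=
  conjFun K (frob k W ^ n) f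

/-- The `n`-fold twist `ξ⁽ⁿ⁾` of a point `ξ` of `X_W`. -/
def Place.twist (n : ℤ) (x : Place W (GeomFunctionField k K W)) :
    Place W (GeomFunctionField k K W) :=
  x.conj (frob k W ^ n)

/-- The `n`-fold twist `E⁽ⁿ⁾` of a divisor `E` of `X_W`. -/
def twistDiv (n : ℤ) (E : Divisor W (GeomFunctionField k K W)) :
    Divisor W (GeomFunctionField k K W) :=
  E.mapDomain (Place.twist n)

end Twist

open Classical in
/-- The ramification index of the point `y` of `X_W` over the closed point `x` of `X`; it is zero if
`y` does not lie over `x`. -/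
def ramIdx (y : Place W (GeomFunctionField k K W)) (x : Place k K) : ℕ :=
  if h : ∃ e : ℕ, 0 < e ∧ ∀ f : K, y.ord (toGeom k K W f) = e • x.ord f then h.choose else 0

/-- The base change to `X_W` of a divisor `D` of `X`, as a function on the points of `X_W`: each
closed point `x` of `X` pulls back to the sum of the points `y` over `x`, with multiplicity the
ramification index. -/
def pullback (W : Type*) [Field W] [Algebra k W] [IsDomain (W ⊗[k] K)] (D : Divisor k K) :
    Place W (GeomFunctionField k K W) → ℤ :=
  fun y => D.sum fun x n => ramIdx y x * n

/-! ## Shtukas -/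

variable [Fintype k] [IsAlgClosed W]

/-- `(D, ξ, η, E)` is a (rank one) shtuka. -/
structure IsShtuka (D : Divisor k K) (ξ η : Place W (GeomFunctionField k K W))
    (E : Divisor W (GeomFunctionField k K W)) : Prop where
  effective : 0 ≤ D
  ne_zero : D ≠ 0
  basepoint_away : pullback W D ξ = 0
  zero_away : pullback W D η = 0
  away : ∀ x, pullback W D x ≠ 0 → E x = 0
  equiv : EquivMod (pullback W D) (E - twistDiv 1 E)
    (-Finsupp.single (ξ.twist 1) 1 + Finsupp.single η 1)
  deg_eq : deg (⇑E) = (genus W (GeomFunctionField k K W) : ℤ) - 1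

/-- Nondegeneracy: `η` is none of the points `ξ⁽ⁱ⁾` with `1 - deg (E + D) ≤ i ≤ g`. -/
def IsNondegenerate (D : Divisor k K) (ξ η : Place W (GeomFunctionField k K W))
    (E : Divisor W (GeomFunctionField k K W)) : Prop :=
  ∀ i : ℤ, 1 - deg (⇑E + pullback W D) ≤ i → i ≤ (genus W (GeomFunctionField k K W) : ℤ) →
    η ≠ ξ.twist i

/-- The `k`-space `Ψ` of the `ψ ∈ H⁰(O(E + D))` such that `ψ - ψ⁽¹⁾` is regular near `D`. -/
def Psi (D : Divisor k K) (E : Divisor W (GeomFunctionField k K W)) :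
    Submodule k (GeomFunctionField k K W) where
  carrier := {ψ | ψ ∈ H0 (⇑E + pullback W D) ∧
    ∀ x : Place W (GeomFunctionField k K W), pullback W D x ≠ 0 → 0 ≤ x.ord (ψ - twistFun 1 ψ)}
  zero_mem' := ⟨zero_mem _, fun x _ => by simp [twistFun]⟩
  add_mem' := fun {a b} ha hb => ⟨add_mem ha.1 hb.1, fun x hx => by
    have h : a + b - twistFun 1 (a + b) = (a - twistFun 1 a) + (b - twistFun 1 b) := by
      simp only [twistFun, map_add]; ring
    rw [h]
    exact x.ord.map_le_add (ha.2 x hx) (hb.2 x hx)⟩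
  smul_mem' := fun c a ha => by
    refine ⟨?_, fun x hx => ?_⟩
    · rw [← algebraMap_smul W c a]
      exact Submodule.smul_mem _ _ ha.1
    · have h : c • a - twistFun 1 (c • a) = algebraMap k W c • (a - twistFun 1 a) := by
        rw [algebraMap_smul, smul_sub]
        simp only [twistFun, map_smul]
      rw [h]
      exact x.le_ord_smul _ (ha.2 x hx)

/-- The natural map `W ⊗ Ψ → L`, `w ⊗ ψ ↦ w ψ`, to the function field `L` of `X_W`. -/
def psiMulMap (D : Divisor k K) (E : Divisor W (GeomFunctionField k K W)) :
    W ⊗[k] Psi D E →ₗ[W] GeomFunctionField k K W :=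
  (Psi D E).subtype.liftBaseChange W

theorem psiMulMap_tmul (D : Divisor k K) (E : Divisor W (GeomFunctionField k K W)) (w : W)
    (ψ : Psi D E) : psiMulMap D E (w ⊗ₜ ψ) = w • (ψ : GeomFunctionField k K W) := by
  simp [psiMulMap]

end BaseChange

end

/-!
Let `f` be the function with divisor `E - E⁽¹⁾ + ξ⁽¹⁾ - η` and value `1` on `D`. The
Frobenius-semilinear map `T φ = φ⁽¹⁾ / f` (`frobDiv`) sends `H⁰(O(E + G))` onto `H⁰(O(E + G⁽¹⁾ +
ξ⁽¹⁾ - η))` (`frobDiv_mem_H0_iff`), and `T φ` has the polar parts of `φ⁽¹⁾` along `D`.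

A function `v` with `T v = v` and `v ∈ H⁰(O(E + G - η))`, where `G = G⁽¹⁾`, has zeros imposed
successively at `η`, `η⁽¹⁾`, `η⁽²⁾`, …: the extra pole allowed by `T` is at `ξ⁽¹⁾`, which
nondegeneracy keeps apart from the next `η⁽ʲ⁾`. When the degree becomes negative, `v = 0`
(`eq_zero_of_frobDiv_fixed`).

*Vanishing of `H⁰(O(E))`* (`H0_eq_bot_of_shtuka`). Put `U_m = H⁰(O(E + ξ⁽¹⁾ + … + ξ⁽ᵐ⁾))`. If `U₁
= U₀`, then `T` maps `U₀` into `H⁰(O(E - η))`; by Lang's theorem `U₀` is spanned by fixed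
functions of `T`, and these vanish by the previous paragraph. If `U₁ ≠ U₀`, applying `T` shows
that `U_{m+1} ≠ U_m` as long as `m + 1 ≤ g`, so `dim U_g ≥ h⁰(O(E)) + g`; but `E + ξ⁽¹⁾ + … +
ξ⁽ᵍ⁾` has degree `2 g - 1`, so `dim U_g = g` by Riemann–Roch. Since `deg E = g - 1`, also
`H¹(O(E)) = 0`.

*The space `Ψ`* (`psiMulMap_injective_range`). As `H⁰(O(E))` and `H¹(O(E))` vanish, each `ψ ∈
H⁰(O(E + D))` determines a unique function in `H⁰(O(E + D))` with the polar parts of `ψ⁽¹⁾` along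
`D`. This defines an injective Frobenius-semilinear endomorphism of `H⁰(O(E + D))` whose space of
fixed vectors is `Ψ`, and Lang's theorem (`span_fixed_eq_top`, `linearIndependent_of_fixed`)
applies.

*Functions in `Ψ` vanishing at `ξ`* (`Psi_inf_H0_eq_bot`). For such `ψ` the function `T ψ - ψ`
lies in `H⁰(O(E)) = 0`, so `ψ = T ψ ∈ H⁰(O(E + D - η))`, and `eq_zero_of_frobDiv_fixed` applies
with `G = D`.

The facts about curves that this needs are proved for a field `L` that is finite over `F(t)` for
every non-constant `t` (`IsFunctionFieldOne`), with `F` algebraically closed: principal divisors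
have degree zero (`deg_principalDivisor`), the Riemann–Roch formula `h⁰ - h¹ = deg + 1 - g` holds
(`finrank_H0_sub_finrank_H1`), and `H¹(O(A)) = 0` if `deg A ≥ 2 g - 1` (`finrank_H1_eq_zero`). The
last fact avoids differentials: a nonzero linear form `ℓ` on `H¹(O(A))` embeds `H⁰(O(A))` into the
dual of `H¹(O)` by `f ↦ ℓ(f ·)`, so that `h⁰(O(A)) ≤ g`.
-/

noncomputable section

section CurveTheory

open Polynomial IntermediateField

/-! ### Places of a function field -/

/-- `L` is a function field in one variable over `F`: it is finite over `F(t)` for every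
non-constant `t`. -/
class IsFunctionFieldOne (F L : Type*) [Field F] [Field L] [Algebra F L] : Prop where
  finite_adjoin : ∀ t : L, t ∉ Set.range (algebraMap F L) → FiniteDimensional F⟮t⟯ L

/-- Clearing denominators and common powers of `t`, a linear relation over `F(t)` becomes one with
coefficients in `F[t]` that are not all divisible by `t`. -/
theorem exists_polynomial_relation {F L : Type*} [Field F] [Field L] [Algebra F L] {t : L}
    (ht : t ≠ 0) {ι : Type*} [Fintype ι] {u : ι → L} (hu : ¬ LinearIndependent F⟮t⟯ u) :
    ∃ p : ι → F[X], (∃ i, (p i).coeff 0 ≠ 0) ∧ ∑ i, aeval t (p i) * u i = 0 := by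
  classical
  obtain ⟨g, hg, i₀, hi₀⟩ := Fintype.not_linearIndependent_iff.mp hu
  have key : ∀ i, ∃ r s : F[X], aeval t s ≠ 0 ∧ (g i : L) * aeval t s = aeval t r := by
    intro i
    obtain ⟨r, s, h⟩ := (mem_adjoin_simple_iff F _).1 (g i).2
    by_cases hs : aeval t s = 0
    · exact ⟨0, 1, by simp, by simp [h, hs]⟩
    · exact ⟨r, s, hs, by rw [h, div_mul_cancel₀ _ hs]⟩
  choose r s hs hr using key
  set q : ι → F[X] := fun i => r i * ∏ j ∈ Finset.univ.erase i, s j with hq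
  have hqi : ∀ i, aeval t (q i) = (∏ j, aeval t (s j)) * (g i : L) := by
    intro i
    rw [hq, ← Finset.mul_prod_erase _ _ (Finset.mem_univ i)]
    simp only [map_mul, map_prod, ← hr i]
    ring
  have hq0 : ∑ i, aeval t (q i) * u i = 0 := by
    have : ∑ i, aeval t (q i) * u i = (∏ j, aeval t (s j)) * ∑ i, g i • u i := by
      rw [Finset.mul_sum]
      refine Finset.sum_congr rfl fun i _ => ?_
      rw [hqi, Algebra.smul_def, mul_assoc]; rfl
    rw [this, hg, mul_zero]
  have hex : ∃ m, ∃ i, (q i).coeff m ≠ 0 := by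
    have h : q i₀ ≠ 0 := by
      intro h
      have h1 := hqi i₀
      rw [h, map_zero] at h1
      exact mul_ne_zero (Finset.prod_ne_zero_iff.mpr fun j _ => hs j)
        (fun h2 => hi₀ (Subtype.ext h2)) h1.symm
    exact ⟨_, i₀, mt leadingCoeff_eq_zero.mp h⟩
  obtain ⟨i₁, hi₁⟩ := Nat.find_spec hex
  have hdvd : ∀ i, X ^ Nat.find hex ∣ q i := by
    intro i
    rw [X_pow_dvd_iff]
    intro d hd
    by_contra h
    exact Nat.find_min hex hd ⟨i, h⟩
  choose p hp using hdvd
  refine ⟨p, ⟨i₁, ?_⟩, ?_⟩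
  · rw [hp i₁] at hi₁
    have := coeff_X_pow_mul (p i₁) (Nat.find hex) 0
    rw [zero_add] at this
    rwa [this] at hi₁
  · have h1 : t ^ Nat.find hex * ∑ i, aeval t (p i) * u i = 0 := by
      rw [← hq0, Finset.mul_sum]
      refine Finset.sum_congr rfl fun i _ => ?_
      conv_rhs => rw [hp i]
      simp [mul_assoc]
    exact (mul_eq_zero.mp h1).resolve_left (pow_ne_zero _ ht)

theorem aeval_eq_coeff_zero_add {F L : Type*} [Field F] [Field L] [Algebra F L] (t : L)
    (p : F[X]) : aeval t p = algebraMap F L (p.coeff 0) + t * aeval t p.divX := by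
  conv_lhs => rw [← divX_mul_X_add p, map_add, map_mul, aeval_X, aeval_C]
  ring

namespace Place

variable {F L : Type*} [Field F] [Field L] [Algebra F L]

@[ext]
theorem ext_ord {x y : Place F L} (h : x.ord = y.ord) : x = y := by
  cases x; cases y; congr

/-- The order of `f` at `x` as an integer, with the value `0` at `f = 0`. -/
def val (x : Place F L) (f : L) : ℤ := (x.ord f).untopD 0

variable (x : Place F L)

theorem coe_val {f : L} (hf : f ≠ 0) : ((x.val f : ℤ) : WithTop ℤ) = x.ord f := by
  obtain ⟨n, hn⟩ := WithTop.ne_top_iff_exists.mp (x.ord.ne_top_iff.mpr hf)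
  rw [val, ← hn]; rfl

theorem val_eq_of_ord_eq {f : L} {n : ℤ} (h : x.ord f = n) : x.val f = n := by
  simp [val, h]

theorem ne_zero_of_ord_eq {f : L} {n : ℤ} (h : x.ord f = n) : f ≠ 0 :=
  x.ord.ne_top_iff.mp (h ▸ WithTop.coe_ne_top)

theorem coe_le_ord_iff {f : L} (hf : f ≠ 0) {n : ℤ} : (n : WithTop ℤ) ≤ x.ord f ↔ n ≤ x.val f := by
  rw [← x.coe_val hf, WithTop.coe_le_coe]

@[simp] theorem val_one : x.val 1 = 0 := by simp [val]

theorem val_mul {f g : L} (hf : f ≠ 0) (hg : g ≠ 0) : x.val (f * g) = x.val f + x.val g := by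
  apply x.val_eq_of_ord_eq
  rw [x.ord.map_mul, ← x.coe_val hf, ← x.coe_val hg]; rfl

theorem val_inv (f : L) : x.val f⁻¹ = - x.val f := by
  by_cases hf : f = 0
  · simp [hf, val]
  · have h := x.val_mul hf (inv_ne_zero hf)
    rw [mul_inv_cancel₀ hf, val_one] at h
    omega

theorem val_pow {f : L} (hf : f ≠ 0) (n : ℕ) : x.val (f ^ n) = n * x.val f := by
  induction n with
  | zero => simp
  | succ n ih => rw [pow_succ, x.val_mul (pow_ne_zero _ hf) hf, ih]; push_cast; ring

theorem val_zpow {f : L} (hf : f ≠ 0) (n : ℤ) : x.val (f ^ n) = n * x.val f := by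
  cases n with
  | ofNat n => simpa using x.val_pow hf n
  | negSucc n => rw [zpow_negSucc, val_inv, x.val_pow hf, Int.negSucc_eq]; push_cast; ring

theorem val_algebraMap (c : F) : x.val (algebraMap F L c) = 0 := by
  by_cases hc : c = 0
  · simp [hc, val]
  · simp [val, x.ord_const c hc]

theorem ord_mul_le {f g : L} {a b : ℤ} (hf : (a : WithTop ℤ) ≤ x.ord f)
    (hg : (b : WithTop ℤ) ≤ x.ord g) : ((a + b : ℤ) : WithTop ℤ) ≤ x.ord (f * g) := by
  rw [x.ord.map_mul, WithTop.coe_add]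
  exact add_le_add hf hg

theorem zero_le_ord_aeval {t : L} (ht : 0 ≤ x.ord t) (p : F[X]) : 0 ≤ x.ord (aeval t p) := by
  induction p using Polynomial.induction_on' with
  | add p q hp hq => rw [map_add]; exact x.ord.map_le_add hp hq
  | monomial n c =>
    rw [aeval_monomial, x.ord.map_mul, x.ord.map_pow]
    exact add_nonneg (x.zero_le_ord_const c) (nsmul_nonneg ht n)

theorem exists_val_eq_one : ∃ t : L, t ≠ 0 ∧ x.val t = 1 := by
  obtain ⟨t, ht⟩ := x.exists_uniformizer
  exact ⟨t, x.ne_zero_of_ord_eq (n := 1) ht, x.val_eq_of_ord_eq (n := 1) ht⟩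

theorem exists_val_eq (n : ℤ) : ∃ t : L, t ≠ 0 ∧ x.val t = n := by
  obtain ⟨t, h0, ht⟩ := x.exists_val_eq_one
  exact ⟨t ^ n, zpow_ne_zero _ h0, by rw [x.val_zpow h0, ht, mul_one]⟩

theorem not_mem_range_of_val_ne_zero {f : L} (h : x.val f ≠ 0) :
    f ∉ Set.range (algebraMap F L) := by
  rintro ⟨c, rfl⟩
  exact h (x.val_algebraMap c)

/-- Every closed point of a curve over an algebraically closed field is rational: a function
regular at `x` has a constant value there. -/
theorem exists_residue [IsAlgClosed F] [IsFunctionFieldOne F L] {f : L} (hf : 0 ≤ x.ord f) :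
    ∃ c : F, 0 < x.ord (f - algebraMap F L c) := by
  by_contra! h
  have h0 : ∀ c : F, x.ord (f - algebraMap F L c) = 0 := fun c =>
    le_antisymm (h c) (x.ord.map_le_sub hf (x.zero_le_ord_const c))
  have hfc : f ∉ Set.range (algebraMap F L) := by
    rintro ⟨c, rfl⟩
    simpa using h0 c
  -- every nonzero element of `F(f)` is a unit at `x`, so `x` is trivial on `L`, finite over `F(f)`
  have hp : ∀ p : F[X], p ≠ 0 → x.ord (aeval f p) = 0 := by
    intro p hp
    rw [(IsAlgClosed.splits p).eq_prod_roots, map_mul, x.ord.map_mul, aeval_C,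
      x.ord_const _ (leadingCoeff_ne_zero.mpr hp), zero_add]
    induction p.roots using Multiset.induction with
    | empty => simp
    | cons a s ih =>
      rw [Multiset.map_cons, Multiset.prod_cons, map_mul, x.ord.map_mul, ih, add_zero]
      simpa using h0 a
  have hE : ∀ g : F⟮f⟯, 0 ≤ x.ord (g : L) := by
    intro g
    obtain ⟨r, s, hrs⟩ := (mem_adjoin_simple_iff F _).1 g.2
    rw [hrs]
    by_cases hr : r = 0
    · simp [hr]
    by_cases hs : s = 0
    · simp [hs]
    rw [x.ord.map_div, hp r hr, hp s hs]
    simp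
  have := IsFunctionFieldOne.finite_adjoin f hfc
  obtain ⟨t, ht0, ht⟩ := x.exists_val_eq_one
  have hint : IsIntegral F⟮f⟯ t := Algebra.IsIntegral.isIntegral t
  have hmem : ∀ z ∈ Algebra.adjoin F⟮f⟯ {t}, 0 ≤ x.ord z := by
    intro z hz
    induction hz using Algebra.adjoin_induction with
    | mem z hz =>
      rw [Set.mem_singleton_iff] at hz
      rw [hz, ← x.coe_val ht0, ht]; exact WithTop.coe_nonneg.mpr zero_le_one
    | algebraMap r => exact hE r
    | add a b _ _ ha hb => exact x.ord.map_le_add ha hb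
    | mul a b _ _ ha hb => rw [x.ord.map_mul]; exact add_nonneg ha hb
  have := hmem _ hint.inv_mem_adjoin
  rw [← x.coe_val (inv_ne_zero ht0), val_inv, ht] at this
  exact absurd (WithTop.coe_nonneg.mp this) (by norm_num)

/-- Two points with `O_x ⊆ O_y` are equal. -/
theorem eq_of_forall_le {x y : Place F L} (h : ∀ f, 0 ≤ x.ord f → 0 ≤ y.ord f) : x = y := by
  have h' : ∀ f, f ≠ 0 → 0 ≤ x.val f → 0 ≤ y.val f := fun f hf hx =>
    (y.coe_le_ord_iff hf).mp (h f ((x.coe_le_ord_iff hf).mpr hx))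
  have hu : ∀ f, f ≠ 0 → x.val f = 0 → y.val f = 0 := by
    intro f hf hx
    have h1 := h' f hf hx.ge
    have h2 := h' f⁻¹ (inv_ne_zero hf) (by rw [val_inv, hx, neg_zero])
    rw [val_inv] at h2
    omega
  obtain ⟨t, ht0, ht⟩ := x.exists_val_eq_one
  have hy : ∀ f, f ≠ 0 → y.val f = x.val f * y.val t := by
    intro f hf
    have h1 := hu (f * t ^ (- x.val f)) (mul_ne_zero hf (zpow_ne_zero _ ht0)) (by
      rw [x.val_mul hf (zpow_ne_zero _ ht0), x.val_zpow ht0, ht]; ring)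
    rw [y.val_mul hf (zpow_ne_zero _ ht0), y.val_zpow ht0] at h1
    linarith
  obtain ⟨s, hs0, hs⟩ := y.exists_val_eq_one
  have h1 := hy s hs0
  have ht1 : y.val t = 1 := by
    have h2 := h' t ht0 (by omega)
    rw [hs] at h1
    exact Int.eq_one_of_mul_eq_one_left h2 h1.symm
  ext f
  by_cases hf : f = 0
  · simp [hf]
  · rw [← x.coe_val hf, ← y.coe_val hf, hy f hf, ht1, mul_one]

theorem exists_val_pos_val_neg {x y : Place F L} (hxy : x ≠ y) :
    ∃ f : L, f ≠ 0 ∧ 0 < x.val f ∧ y.val f < 0 := by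
  have key : ∀ {x y : Place F L}, x ≠ y → ∃ f : L, f ≠ 0 ∧ 0 ≤ x.val f ∧ y.val f < 0 := by
    intro x y hxy
    by_contra! h
    refine hxy (eq_of_forall_le fun f hf => ?_)
    by_cases hf0 : f = 0
    · simp [hf0]
    · exact (y.coe_le_ord_iff hf0).mpr (h f hf0 ((x.coe_le_ord_iff hf0).mp hf))
  obtain ⟨a, ha0, hax, hay⟩ := key hxy
  obtain ⟨b, hb0, hby, hbx⟩ := key hxy.symm
  refine ⟨a * b⁻¹, mul_ne_zero ha0 (inv_ne_zero hb0), ?_, ?_⟩ <;>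
  · rw [val_mul _ ha0 (inv_ne_zero hb0), val_inv]
    omega

theorem val_add_eq_of_lt {f g : L} (hf : f ≠ 0) (hg : g ≠ 0) (h : x.val f < x.val g) :
    f + g ≠ 0 ∧ x.val (f + g) = x.val f := by
  have : x.ord (f + g) = x.val f := by
    rw [x.ord.map_add_eq_of_lt_left, x.coe_val hf]
    rw [← x.coe_val hf, ← x.coe_val hg]
    exact WithTop.coe_lt_coe.mpr h
  exact ⟨x.ne_zero_of_ord_eq this, x.val_eq_of_ord_eq this⟩

theorem val_add_pos {f g : L} (hf : f ≠ 0) (hg : g ≠ 0) (hfg : f + g ≠ 0) (h1 : 0 < x.val f)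
    (h2 : 0 < x.val g) : 0 < x.val (f + g) := by
  have h3 := x.ord.map_le_add (g := ((1 : ℤ) : WithTop ℤ)) ((x.coe_le_ord_iff hf).mpr h1)
    ((x.coe_le_ord_iff hg).mpr h2)
  exact (x.coe_le_ord_iff hfg).mp h3

/-- A function with a zero at `x` and poles at finitely many other points. -/
theorem exists_val_pos_forall_val_neg (S : Finset (Place F L)) (hS : x ∉ S) :
    ∃ f : L, f ≠ 0 ∧ 0 < x.val f ∧ ∀ y ∈ S, y.val f < 0 := by
  classical
  induction S using Finset.induction_on with
  | empty =>
    obtain ⟨t, h0, ht⟩ := x.exists_val_eq_one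
    exact ⟨t, h0, by omega, by simp⟩
  | insert y S hy ih =>
    rw [Finset.mem_insert, not_or] at hS
    obtain ⟨f, hf0, hfx, hfS⟩ := ih hS.2
    obtain ⟨g, hg0, hgx, hgy⟩ := exists_val_pos_val_neg hS.1
    by_cases hfy : y.val f < 0
    · exact ⟨f, hf0, hfx, fun z hz => by
        rcases Finset.mem_insert.mp hz with rfl | hz
        exacts [hfy, hfS z hz]⟩
    -- a large power of `g` has an order different from that of `f` at all points of `S`
    obtain ⟨r, hr⟩ : ∃ r : ℕ, ∀ z ∈ S, -z.val f < r := by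
      refine ⟨(∑ z ∈ S, (-z.val f).toNat) + 1, fun z hz => ?_⟩
      have := Finset.single_le_sum (f := fun z : Place F L => (-z.val f).toNat)
        (fun _ _ => Nat.zero_le _) hz
      omega
    have hgr : g ^ (r + 1) ≠ 0 := pow_ne_zero _ hg0
    have hv : ∀ z : Place F L, z.val (g ^ (r + 1)) = (r + 1) * z.val g := fun z => by
      rw [z.val_pow hg0]; push_cast; ring
    have hy1 : f + g ^ (r + 1) ≠ 0 ∧ y.val (f + g ^ (r + 1)) = y.val (g ^ (r + 1)) := by
      rw [add_comm]
      refine y.val_add_eq_of_lt hgr hf0 ?_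
      rw [hv]; nlinarith
    refine ⟨f + g ^ (r + 1), hy1.1, ?_, ?_⟩
    · exact x.val_add_pos hf0 hgr hy1.1 hfx (by rw [hv]; positivity)
    · intro z hz
      rcases Finset.mem_insert.mp hz with rfl | hz
      · rw [hy1.2, hv]; nlinarith
      · have h1 := hfS z hz
        have h2 := hr z hz
        rcases lt_or_ge (z.val g) 0 with h3 | h3
        · rw [add_comm, (z.val_add_eq_of_lt hgr hf0 (by rw [hv]; nlinarith)).2, hv]
          nlinarith
        · rw [(z.val_add_eq_of_lt hf0 hgr (by rw [hv]; nlinarith)).2]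
          exact h1

/-- Weak approximation: a function can be approximated to any order at `x` by one that vanishes to
any order at finitely many other points. -/
theorem exists_approx (S : Finset (Place F L)) (hS : x ∉ S) {f : L} (hf : f ≠ 0) (M : ℤ) :
    ∃ u : L, (M : WithTop ℤ) ≤ x.ord (u - f) ∧ ∀ y ∈ S, (M : WithTop ℤ) ≤ y.ord u := by
  classical
  obtain ⟨g, hg0, hgx, hgS⟩ := x.exists_val_pos_forall_val_neg S hS
  obtain ⟨N, hN⟩ : ∃ N : ℕ, ∀ y ∈ insert x S, M - y.val f < N := by
    refine ⟨(∑ z ∈ insert x S, (M - z.val f).toNat) + 1, fun z hz => ?_⟩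
    have := Finset.single_le_sum (f := fun z : Place F L => (M - z.val f).toNat)
      (fun _ _ => Nat.zero_le _) hz
    omega
  have hgN : g ^ (N + 1) ≠ 0 := pow_ne_zero _ hg0
  have hv : ∀ z : Place F L, z.val (g ^ (N + 1)) = (N + 1) * z.val g := fun z => by
    rw [z.val_pow hg0]; push_cast; ring
  obtain ⟨h10, h1x⟩ := x.val_add_eq_of_lt one_ne_zero hgN (by rw [hv, val_one]; positivity)
  rw [val_one] at h1x
  have h1 : ∀ y ∈ S, y.val (1 + g ^ (N + 1)) = (N + 1) * y.val g := by
    intro y hy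
    have := hgS y hy
    rw [add_comm, (y.val_add_eq_of_lt hgN one_ne_zero (by rw [hv, val_one]; nlinarith)).2, hv]
  refine ⟨f * (1 + g ^ (N + 1))⁻¹, ?_, fun y hy => ?_⟩
  · have : f * (1 + g ^ (N + 1))⁻¹ - f = -(f * (g ^ (N + 1) * (1 + g ^ (N + 1))⁻¹)) := by
      field_simp; ring
    rw [this, x.ord.map_neg, x.coe_le_ord_iff (by positivity),
      x.val_mul hf (by positivity), x.val_mul hgN (inv_ne_zero h10), val_inv, h1x, hv]
    have := hN x (Finset.mem_insert_self _ _)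
    nlinarith
  · rw [y.coe_le_ord_iff (by positivity), y.val_mul hf (inv_ne_zero h10), val_inv, h1 y hy]
    have := hN y (Finset.mem_insert_of_mem hy)
    have := hgS y hy
    nlinarith

end Place

/-! ### Zeros, and the existence of poles -/

namespace Place

variable {F L : Type*} [Field F] [Field L] [Algebra F L] (x : Place F L)

/-- A polynomial of degree less than `e` in a uniformizer has order at least `e` only if all its
coefficients vanish: otherwise its order is the index of the first nonzero coefficient. -/
theorem coeff_eq_zero_of_le_ord {t : L} (ht0 : t ≠ 0) (ht : x.val t = 1) {e : ℕ} (a : Fin e → F)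
    (h : ((e : ℤ) : WithTop ℤ) ≤ x.ord (∑ j, algebraMap F L (a j) * t ^ (j : ℕ))) (j : Fin e) :
    a j = 0 := by
  induction j using WellFoundedLT.induction with
  | _ j ih =>
  by_contra haj
  have hord : ∀ i : Fin e, x.ord (t ^ (i : ℕ)) = ((i : ℤ) : WithTop ℤ) := fun i => by
    rw [← x.coe_val (pow_ne_zero _ ht0), x.val_pow ht0, ht, mul_one]
  have h1 : ((j + 1 : ℤ) : WithTop ℤ) ≤ x.ord (algebraMap F L (a j) * t ^ (j : ℕ)) := by
    rw [← Finset.add_sum_erase _ _ (Finset.mem_univ j)] at h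
    rw [← add_sub_cancel_right (algebraMap F L (a j) * t ^ (j : ℕ))]
    refine x.ord.map_le_sub (le_trans (WithTop.coe_le_coe.mpr (by have := j.2; omega)) h)
      (x.ord.map_le_sum fun i hi => ?_)
    rcases lt_or_gt_of_ne (Finset.ne_of_mem_erase hi) with hij | hij
    · simp [ih i hij]
    · rw [← Algebra.smul_def]
      refine x.le_ord_smul _ ?_
      rw [hord]
      exact WithTop.coe_le_coe.mpr (by have : (j : ℕ) < i := hij; omega)
  rw [x.ord.map_mul, x.ord_const _ haj, zero_add, hord, WithTop.coe_le_coe] at h1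
  omega

/-- The zeros of a non-constant function `t`, counted with multiplicity, are at most `[L : F(t)]`
in number: functions approximating the powers `π_x ^ j`, `j < ord_x t`, of uniformizers at the
zeros `x` are linearly independent over `F(t)`. -/
theorem sum_val_le_finrank [IsFunctionFieldOne F L] {t : L} (htc : t ∉ Set.range (algebraMap F L))
    (S : Finset (Place F L)) (hS : ∀ x ∈ S, 0 < x.val t) :
    ∑ x ∈ S, x.val t ≤ Module.finrank F⟮t⟯ L := by
  classical
  have hfin := IsFunctionFieldOne.finite_adjoin t htc
  have ht0 : t ≠ 0 := by rintro rfl; exact htc ⟨0, map_zero _⟩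
  set M : ℤ := ∑ x ∈ S, x.val t with hM
  have hle : ∀ x ∈ S, x.val t ≤ M := fun x hx =>
    Finset.single_le_sum (f := fun x : Place F L => x.val t) (fun y hy => (hS y hy).le) hx
  choose π hπ0 hπ using fun x : Place F L => x.exists_val_eq_one
  have happ : ∀ (x : Place F L) (j : ℕ), ∃ u : L, (M : WithTop ℤ) ≤ x.ord (u - π x ^ j) ∧
      ∀ y ∈ S.erase x, (M : WithTop ℤ) ≤ y.ord u := fun x j =>
    x.exists_approx (S.erase x) (Finset.notMem_erase x S) (pow_ne_zero j (hπ0 x)) M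
  choose u hu hu' using happ
  let ι := Σ x : S, Fin (x.1.val t).toNat
  let v : ι → L := fun i => u i.1 i.2
  have hcard : (Fintype.card ι : ℤ) = M := by
    simp only [ι, Fintype.card_sigma, Fintype.card_fin]
    push_cast
    rw [hM, ← Finset.sum_coe_sort S]
    exact Finset.sum_congr rfl fun x _ => Int.toNat_of_nonneg (hS x x.2).le
  -- in a relation with coefficients `p i ∈ F[t]` not all divisible by `t`, the terms of order less
  -- than `ord_x t` at `x` form a polynomial in `π_x` with coefficients `p i (0)`
  suffices hv : LinearIndependent F⟮t⟯ v by
    rw [← hcard]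
    exact_mod_cast hv.fintype_card_le_finrank
  by_contra hv
  obtain ⟨p, ⟨i₀, hi₀⟩, hp⟩ := exists_polynomial_relation ht0 hv
  obtain ⟨x, hx⟩ := i₀.1
  refine hi₀ ?_
  have hxM := hle _ i₀.1.2
  obtain ⟨x, j₀⟩ := i₀
  have hx := hS x x.2
  refine coeff_eq_zero_of_le_ord x.1 (hπ0 x) (hπ x) (fun j => (p ⟨x, j⟩).coeff 0) ?_ j₀
  rw [Int.toNat_of_nonneg hx.le]
  let w : ι → L := fun i => if i.1 = x then algebraMap F L ((p i).coeff 0) * π x ^ (i.2 : ℕ) else 0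
  have hw : ∑ j, algebraMap F L ((p ⟨x, j⟩).coeff 0) * π x ^ (j : ℕ) =
      ∑ i, (w i - aeval t (p i) * v i) := by
    rw [Finset.sum_sub_distrib, hp, sub_zero, Fintype.sum_sigma,
      Finset.sum_eq_single x (fun y _ hy => Finset.sum_eq_zero fun j _ => if_neg hy) (by simp)]
    exact Finset.sum_congr rfl fun j _ => (if_pos rfl).symm
  rw [hw]
  have htx : ((x.1.val t : ℤ) : WithTop ℤ) ≤ x.1.ord t := (x.1.coe_val ht0).le
  have ht : 0 ≤ x.1.ord t := le_trans (WithTop.coe_le_coe.mpr hx.le) htx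
  refine x.1.ord.map_le_sum fun i _ => ?_
  by_cases hi : i.1 = x
  · have hux : ((x.1.val t : ℤ) : WithTop ℤ) ≤ x.1.ord (u x i.2 - π x ^ (i.2 : ℕ)) :=
      le_trans (WithTop.coe_le_coe.mpr hxM) (hu x i.2)
    have hu0 : ((0 : ℤ) : WithTop ℤ) ≤ x.1.ord (u x i.2) := by
      rw [← sub_add_cancel (u x i.2) (π x ^ (i.2 : ℕ))]
      refine x.1.ord.map_le_add (le_trans (WithTop.coe_le_coe.mpr hx.le) hux) ?_
      rw [x.1.coe_le_ord_iff (pow_ne_zero _ (hπ0 _)), x.1.val_pow (hπ0 _), hπ]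
      positivity
    have hvi : v i = u x i.2 := by simp only [v, hi]
    have : w i - aeval t (p i) * v i =
        -((p i).coeff 0 • (u x i.2 - π x ^ (i.2 : ℕ))) - t * (aeval t (p i).divX * u x i.2) := by
      simp only [w, if_pos hi]
      rw [hvi, aeval_eq_coeff_zero_add, Algebra.smul_def]
      ring
    rw [this]
    refine x.1.ord.map_le_sub ?_ ?_
    · rw [x.1.ord.map_neg]
      exact x.1.le_ord_smul _ hux
    · rw [← add_zero (x.1.val t)]
      refine x.1.ord_mul_le htx ?_
      rw [x.1.ord.map_mul]
      exact add_nonneg (x.1.zero_le_ord_aeval ht _) hu0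
  · simp only [w, if_neg hi]
    rw [zero_sub, x.1.ord.map_neg, ← zero_add (x.1.val t)]
    refine x.1.ord_mul_le (x.1.zero_le_ord_aeval ht _)
      (le_trans (WithTop.coe_le_coe.mpr hxM) (hu' _ _ _ ?_))
    exact Finset.mem_erase.mpr ⟨fun h => hi (Subtype.ext h.symm), x.2⟩

theorem finite_zeros [IsFunctionFieldOne F L] (t : L) : {x : Place F L | 0 < x.val t}.Finite := by
  by_cases htc : t ∈ Set.range (algebraMap F L)
  · convert! Set.finite_empty
    ext x
    by_contra h
    simp only [Set.mem_ofPred_eq, Set.mem_empty_iff_false, iff_false, not_not] at h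
    exact x.not_mem_range_of_val_ne_zero h.ne' htc
  · by_contra hinf
    obtain ⟨S, hS, hcard⟩ := Set.Infinite.exists_subset_card_eq hinf
      (Module.finrank F⟮t⟯ L + 1)
    have h1 := sum_val_le_finrank htc S hS
    have h2 : ∑ x ∈ S, (1 : ℤ) ≤ ∑ x ∈ S, x.val t := Finset.sum_le_sum fun x hx => hS hx
    simp [hcard] at h2
    omega

theorem finite_val_ne_zero [IsFunctionFieldOne F L] (t : L) :
    {x : Place F L | x.val t ≠ 0}.Finite := by
  refine ((finite_zeros (F := F) t).union (finite_zeros (F := F) t⁻¹)).subset fun x hx => ?_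
  simp only [Set.mem_ofPred_eq, Set.mem_union, val_inv] at hx ⊢
  omega

open Classical in
/-- The closed point given by a discrete valuation in multiplicative notation. -/
def ofValuation (v : Valuation L (WithZero (Multiplicative ℤ)))
    (hF : ∀ c : F, c ≠ 0 → v (algebraMap F L c) = 1) (hπ : ∃ t, v t = WithZero.exp (-1 : ℤ)) :
    Place F L where
  ord := AddValuation.of (fun f => if f = 0 then ⊤ else ((-(WithZero.log (v f)) : ℤ) : WithTop ℤ))
    (by simp) (by simp)
    (fun f g => by
      by_cases hf : f = 0
      · simp [hf]
      by_cases hg : g = 0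
      · simp [hg]
      by_cases hfg : f + g = 0
      · simp [hfg]
      simp only [hf, hg, hfg, if_false]
      rw [← WithTop.coe_min, WithTop.coe_le_coe, min_neg_neg, neg_le_neg_iff]
      rcases le_max_iff.mp (v.map_add f g) with h | h
      · exact le_max_of_le_left ((WithZero.log_le_log (by simpa) (by simpa)).mpr h)
      · exact le_max_of_le_right ((WithZero.log_le_log (by simpa) (by simpa)).mpr h))
    (fun f g => by
      by_cases hf : f = 0
      · simp [hf]
      by_cases hg : g = 0
      · simp [hg]
      simp only [hf, hg, mul_eq_zero, or_self, if_false]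
      rw [v.map_mul, WithZero.log_mul (by simpa) (by simpa), neg_add]
      rfl)
  ord_const := fun c hc => by
    simp [AddValuation.of_apply, hF c hc, hc]
  exists_uniformizer := by
    obtain ⟨t, ht⟩ := hπ
    have ht0 : t ≠ 0 := by
      rintro rfl
      rw [map_zero] at ht
      exact WithZero.exp_ne_zero ht.symm
    exact ⟨t, by simp [AddValuation.of_apply, ht, ht0]⟩

theorem ofValuation_val {v : Valuation L (WithZero (Multiplicative ℤ))}
    (hF : ∀ c : F, c ≠ 0 → v (algebraMap F L c) = 1) (hπ : ∃ t, v t = WithZero.exp (-1 : ℤ))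
    {f : L} (hf : f ≠ 0) : (ofValuation v hF hπ).val f = -(WithZero.log (v f)) := by
  apply val_eq_of_ord_eq
  simp [ofValuation, AddValuation.of_apply, hf]

end Place

section Existence

variable {F L : Type*} [Field F] [Field L] [Algebra F L]

/-- The values below `1` of a valuation of a function field that is trivial on the constants satisfy
the ascending chain condition: functions with strictly increasing values are linearly independent
over the subfield generated by the first of them. -/
theorem not_strictMono_valuation [IsFunctionFieldOne F L] {Γ₀ : Type*}
    [LinearOrderedCommGroupWithZero Γ₀]
    (v : Valuation L Γ₀) (hF : ∀ c : F, c ≠ 0 → v (algebraMap F L c) = 1) (s : ℕ → L)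
    (h0 : s 0 ≠ 0) (h1 : ∀ i, v (s i) < 1) : ¬ StrictMono fun i => v (s i) := by
  intro hs
  set t := s 0 with ht
  have htc : t ∉ Set.range (algebraMap F L) := by
    rintro ⟨c, hc⟩
    have := h1 0
    rw [← ht, ← hc, hF c (by rintro rfl; exact h0 (by rw [← hc, map_zero]))] at this
    exact lt_irrefl _ this
  have hF' : ∀ c : F, v (algebraMap F L c) ≤ 1 := fun c => by
    by_cases hc : c = 0
    · simp [hc]
    · exact (hF c hc).le
  have hfin := IsFunctionFieldOne.finite_adjoin t htc
  have hdep : ¬ LinearIndependent F⟮t⟯ fun i : Fin (Module.finrank F⟮t⟯ L + 1) => s i := by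
    intro h
    simpa using h.fintype_card_le_finrank
  obtain ⟨p, ⟨i₀, hi₀⟩, hp⟩ := exists_polynomial_relation h0 hdep
  classical
  obtain ⟨j, hj, hmax⟩ := (Finset.univ.filter fun i => (p i).coeff 0 ≠ 0).exists_max_image id
    ⟨i₀, by simpa using hi₀⟩
  have hj : (p j).coeff 0 ≠ 0 := by simpa using hj
  have hmax : ∀ i, (p i).coeff 0 ≠ 0 → i ≤ j := by simpa using hmax
  have hmono : ∀ i k : ℕ, i ≤ k → v (s i) ≤ v (s k) := fun i k h => hs.monotone h
  have hpos : ∀ i, 0 < v (s i) := fun i =>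
    lt_of_lt_of_le ((v.pos_iff).mpr h0) (hmono 0 i (Nat.zero_le i))
  have haev : ∀ q : F[X], v (aeval t q) ≤ 1 := by
    intro q
    induction q using Polynomial.induction_on' with
    | add p q hp hq => rw [map_add]; exact v.map_add_le hp hq
    | monomial n c =>
      rw [aeval_monomial, v.map_mul, v.map_pow]
      exact mul_le_one' (hF' c) (pow_le_one' (h1 0).le n)
  have hterm : ∀ i : Fin (Module.finrank F⟮t⟯ L + 1),
      v ((if i = j then algebraMap F L ((p j).coeff 0) * s j else 0) - aeval t (p i) * s i)
        < v (s j) := by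
    intro i
    have htail : v (t * (aeval t (p i).divX * s i)) < v (s j) := by
      rw [v.map_mul, v.map_mul]
      calc v t * (v (aeval t (p i).divX) * v (s i)) ≤ v (s j) * (1 * v (s i)) := by
            gcongr
            · exact hmono 0 j (Nat.zero_le _)
            · exact haev _
        _ < v (s j) := by
            rw [one_mul]
            exact mul_lt_of_lt_one_right (hpos j) (h1 i)
    rcases lt_trichotomy i j with hij | rfl | hij
    · rw [if_neg hij.ne, zero_sub, v.map_neg, v.map_mul]
      calc v (aeval t (p i)) * v (s i) ≤ 1 * v (s i) := by gcongr; exact haev _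
        _ < v (s j) := by rw [one_mul]; exact hs hij
    · rw [if_pos rfl, aeval_eq_coeff_zero_add, add_mul, sub_add_cancel_left, v.map_neg, mul_assoc]
      exact htail
    · have : (p i).coeff 0 = 0 := by
        by_contra h
        exact absurd (hmax i h) (not_le.mpr hij)
      rw [if_neg hij.ne', zero_sub, v.map_neg, aeval_eq_coeff_zero_add, this, map_zero, zero_add,
        mul_assoc]
      exact htail
  -- the term with the largest index `j` such that `p j (0) ≠ 0` dominates the relation
  have hsum := v.map_sum_lt (s := Finset.univ) (hpos j).ne' fun i _ => hterm i
  rw [Finset.sum_sub_distrib, hp, Finset.sum_ite_eq' Finset.univ j, if_pos (Finset.mem_univ j),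
    sub_zero, v.map_mul, hF _ hj, one_mul] at hsum
  exact lt_irrefl _ hsum

/-- A valuation ring of a function field that contains the constants is a discrete valuation
ring or the whole field. -/
theorem ValuationSubring.isPrincipalIdealRing_of_forall_mem [IsFunctionFieldOne F L]
    (V : ValuationSubring L)
    (hV : ∀ c : F, algebraMap F L c ∈ V) : IsPrincipalIdealRing V := by
  have hF : ∀ c : F, c ≠ 0 → V.valuation (algebraMap F L c) = 1 := by
    intro c hc
    have h1 := (V.valuation_le_one_iff _).mpr (hV c)
    have h2 := (V.valuation_le_one_iff _).mpr (hV c⁻¹)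
    rw [map_inv₀, map_inv₀] at h2
    refine le_antisymm h1 ?_
    exact (inv_le_one₀ (by rw [Valuation.pos_iff]; simpa using hc)).mp h2
  have hlt : ∀ p q : V, DvdNotUnit p q → V.valuation (q : L) < V.valuation (p : L) := by
    rintro p q ⟨hp, y, hy, rfl⟩
    have hy1 : V.valuation (y : L) < 1 :=
      lt_of_le_of_ne (V.valuation_le_one y) fun h => hy ((V.valuation_eq_one_iff y).mpr h)
    have hp0 : 0 < V.valuation (p : L) := (Valuation.pos_iff _).mpr (by simpa using hp)
    rw [MulMemClass.coe_mul, map_mul]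
    exact mul_lt_of_lt_one_right hp0 hy1
  have hwf : WfDvdMonoid V := by
    refine ⟨wellFounded_iff_isEmpty_descending_chain.mpr ⟨fun ⟨s, hs⟩ => ?_⟩⟩
    refine not_strictMono_valuation V.valuation hF (fun i => (s (i + 1) : L)) ?_ ?_ ?_
    · have := (hs 0).1
      simpa using this
    · intro i
      exact lt_of_lt_of_le (hlt _ _ (hs (i + 1))) (V.valuation_le_one _)
    · exact strictMono_nat_of_lt_succ fun i => hlt _ _ (hs (i + 1))
  exact ((IsBezout.TFAE (R := V)).out 3 1).mp hwf

/-- Every non-constant function has a pole: a valuation ring that contains the constants but not the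
given function is discrete. -/
theorem exists_val_neg [IsAlgClosed F] [IsFunctionFieldOne F L] {t : L}
    (ht : t ∉ Set.range (algebraMap F L)) :
    ∃ x : Place F L, x.val t < 0 := by
  have ht0 : t ≠ 0 := by rintro rfl; exact ht ⟨0, map_zero _⟩
  obtain ⟨V, hV, htV⟩ : ∃ V : ValuationSubring L, (∀ c : F, algebraMap F L c ∈ V) ∧ t ∉ V := by
    -- an element of all valuation rings containing the constants is integral over them
    by_contra! h
    have h1 : t ∈ (integralClosure (Subring.closure (Set.range (algebraMap F L))) L).toSubring := by
      rw [← iInf_valuationSubring_superset, Subring.mem_iInf]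
      rintro ⟨V, hV⟩
      exact h V fun c => hV ⟨c, rfl⟩
    obtain ⟨p, hp, hpt⟩ : IsIntegral (Subring.closure (Set.range (algebraMap F L))) t := h1
    have hcl : ∀ a : Subring.closure (Set.range (algebraMap F L)), ∃ c, algebraMap F L c = a := by
      intro a
      have h : (a : L) ∈ (algebraMap F L).range := by
        rw [← Subring.closure_eq (algebraMap F L).range, RingHom.coe_range]
        exact a.2
      exact h
    have hcl' : ∀ a ∈ (algebraMap (Subring.closure (Set.range (algebraMap F L))) L).range,
        a ∈ (algebraMap F L).range := by
      rintro _ ⟨a, rfl⟩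
      exact hcl a
    obtain ⟨q, hq, -, hqm⟩ := Polynomial.lifts_and_degree_eq_and_monic (f := algebraMap F L)
      (p := p.map (algebraMap (Subring.closure (Set.range (algebraMap F L))) L))
      ((Polynomial.lifts_iff_coeff_lifts _).mpr fun n => by
        rw [coeff_map]; exact hcl' _ ⟨_, rfl⟩) (hp.map _)
    have hint : IsIntegral F t := ⟨q, hqm, by
      rw [← eval_map, hq, eval_map]; exact hpt⟩
    exact ht (minpoly.mem_range_of_degree_eq_one F t
      (IsAlgClosed.degree_eq_one_of_irreducible F (minpoly.irreducible hint)))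
  have := V.isPrincipalIdealRing_of_forall_mem hV
  have hti : t⁻¹ ∈ V := (V.mem_or_inv_mem t).resolve_left htV
  have htm : (⟨t⁻¹, hti⟩ : V) ∈ IsLocalRing.maximalIdeal V := by
    rw [IsLocalRing.mem_maximalIdeal, mem_nonunits_iff]
    intro h
    obtain ⟨b, hb⟩ := h.exists_right_inv
    have hb' : t⁻¹ * (b : L) = 1 := congrArg Subtype.val hb
    refine htV ?_
    have hbt : (b : L) = t := by rw [eq_inv_of_mul_eq_one_right hb', inv_inv]
    exact hbt ▸ b.2
  have : IsDiscreteValuationRing V :=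
    { not_a_field' := fun h => by
        rw [h, Ideal.mem_bot] at htm
        exact inv_ne_zero ht0 (congrArg Subtype.val htm) }
  let v := (IsDiscreteValuationRing.maximalIdeal V).valuation L
  have hvV : ∀ a ∈ V, v a ≤ 1 := fun a ha =>
    IsDedekindDomain.HeightOneSpectrum.valuation_le_one _ (⟨a, ha⟩ : V)
  have hF : ∀ c : F, c ≠ 0 → v (algebraMap F L c) = 1 := by
    intro c hc
    have h1 := hvV _ (hV c)
    have h2 := hvV _ (hV c⁻¹)
    rw [map_inv₀, map_inv₀] at h2
    refine le_antisymm h1 ?_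
    exact (inv_le_one₀ (by rw [Valuation.pos_iff]; simpa using hc)).mp h2
  refine ⟨Place.ofValuation v hF
    (IsDedekindDomain.HeightOneSpectrum.valuation_exists_uniformizer L _), ?_⟩
  have h1 : v t⁻¹ < 1 :=
    (IsDedekindDomain.HeightOneSpectrum.valuation_lt_one_iff_mem _ (⟨t⁻¹, hti⟩ : V)).mpr htm
  rw [Place.ofValuation_val _ _ ht0, neg_neg_iff_pos, ← WithZero.log_one]
  rw [map_inv₀] at h1
  refine (WithZero.log_lt_log one_ne_zero (by simpa using ht0)).mpr ?_
  exact (inv_lt_one₀ (by rw [Valuation.pos_iff]; exact ht0)).mp h1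

end Existence

/-! ### Divisors and the effect of adding one point -/

section Degree

variable {F L : Type*} [Field F] [Field L] [Algebra F L]

theorem deg_coe_eq_sum (A : Divisor F L) : deg (⇑A) = A.sum fun _ n => n :=
  finsum_eq_sum_of_support_subset _ (by simp)

@[simp] theorem deg_zero : deg (0 : Place F L → ℤ) = 0 := by simp [deg]

theorem deg_coe_add (A B : Divisor F L) : deg (⇑(A + B)) = deg (⇑A) + deg (⇑B) := by
  classical
  simp only [deg_coe_eq_sum]
  exact Finsupp.sum_add_index' (fun _ => rfl) (fun _ _ _ => rfl)

theorem deg_coe_neg (A : Divisor F L) : deg (⇑(-A)) = -deg (⇑A) := by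
  have := deg_coe_add A (-A)
  rw [add_neg_cancel, Finsupp.coe_zero, deg_zero] at this
  linarith

theorem deg_coe_sub (A B : Divisor F L) : deg (⇑(A - B)) = deg (⇑A) - deg (⇑B) := by
  rw [sub_eq_add_neg, deg_coe_add, deg_coe_neg]; ring

theorem deg_single (x : Place F L) (n : ℤ) : deg (⇑(Finsupp.single x n)) = n := by
  rw [deg_coe_eq_sum, Finsupp.sum_single_index rfl]

theorem deg_nonneg {A : Divisor F L} (h : 0 ≤ A) : 0 ≤ deg (⇑A) := by
  rw [deg_coe_eq_sum]
  exact Finset.sum_nonneg fun x _ => h x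

theorem deg_nsmul (n : ℕ) (A : Divisor F L) : deg (⇑(n • A)) = n * deg (⇑A) := by
  induction n with
  | zero => simp
  | succ n ih => rw [succ_nsmul, deg_coe_add, ih]; push_cast; ring

theorem Divisor.iff_of_forall_add_single {P : Divisor F L → Prop}
    (h : ∀ A x, P A ↔ P (A + Finsupp.single x 1)) (A B : Divisor F L) : P A ↔ P B := by
  have key : ∀ C A : Divisor F L, P A ↔ P (A + C) := by
    intro C
    induction C using Finsupp.induction_linear with
    | zero => simp
    | add C D hC hD => intro A; rw [hC A, hD (A + C), add_assoc]
    | single x n =>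
      induction n using Int.induction_on with
      | zero => simp
      | succ n ih => intro A; rw [Finsupp.single_add, ← add_assoc, ← h]; exact ih A
      | pred n ih =>
        intro A
        rw [Finsupp.single_sub, h (A + _) x, ih A]
        congr! 1
        abel
  simpa using key (B - A) A

theorem Divisor.le_induction {A B : Divisor F L} (hAB : A ≤ B) {P : Divisor F L → Prop} (h0 : P A)
    (hs : ∀ C x, A ≤ C → P C → P (C + Finsupp.single x 1)) : P B := by
  obtain ⟨n, hn⟩ : ∃ n : ℕ, deg (⇑(B - A)) = n :=
    Int.eq_ofNat_of_zero_le (deg_nonneg (sub_nonneg.mpr hAB))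
  induction n generalizing B with
  | zero =>
    have : B - A = 0 := by
      ext x
      rw [deg_coe_eq_sum, Finsupp.sum, Nat.cast_zero,
        Finset.sum_eq_zero_iff_of_nonneg fun x _ => sub_nonneg.mpr hAB x] at hn
      by_contra hx
      exact hx (hn x (Finsupp.mem_support_iff.mpr hx))
    rwa [sub_eq_zero.mp this]
  | succ n ih =>
    have hne : B - A ≠ 0 := by
      intro h
      rw [h, Finsupp.coe_zero, deg_zero] at hn
      omega
    obtain ⟨x, hx⟩ := Finsupp.ne_iff.mp hne
    have hx' : A x < B x := by
      have := hAB x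
      rw [Finsupp.sub_apply, Finsupp.coe_zero, Pi.zero_apply, sub_ne_zero] at hx
      omega
    have hle : A ≤ B - Finsupp.single x 1 := by
      classical
      intro y
      have := hAB y
      rw [Finsupp.sub_apply, Finsupp.single_apply]
      split_ifs with h
      · subst h; omega
      · omega
    have h1 := hs _ x hle (ih hle (by
      rw [sub_right_comm, deg_coe_sub, hn, deg_single]; push_cast; ring))
    rwa [sub_add_cancel] at h1

end Degree

section LinearAlgebra

variable {F V : Type*} [Field F] [AddCommGroup V] [Module F V]

theorem Submodule.finrank_sup_span_singleton_of_notMem {p : Submodule F V} [Module.Finite F p]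
    {v : V} (hv : v ∉ p) :
    Module.finrank F (p ⊔ F ∙ v : Submodule F V) = Module.finrank F p + 1 := by
  have h := Submodule.finrank_sup_add_finrank_inf_eq p (F ∙ v)
  have hv0 : v ≠ 0 := by rintro rfl; exact hv p.zero_mem
  rw [(Submodule.disjoint_span_singleton' hv0).mpr hv |>.eq_bot, finrank_bot,
    finrank_span_singleton hv0] at h
  exact h

theorem Submodule.quotient_sup_span_singleton {p : Submodule F V} {v : V} (hv : v ∉ p) :
    (Module.Finite F (V ⧸ p) ↔ Module.Finite F (V ⧸ (p ⊔ F ∙ v))) ∧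
    (Module.Finite F (V ⧸ p) →
      Module.finrank F (V ⧸ p) = Module.finrank F (V ⧸ (p ⊔ F ∙ v)) + 1) := by
  have e := Submodule.quotientQuotientEquivQuotient p (p ⊔ F ∙ v) le_sup_left
  have hmap : Submodule.map p.mkQ (p ⊔ F ∙ v) = F ∙ (p.mkQ v) := by
    rw [Submodule.map_sup, Submodule.mkQ_map_self, bot_sup_eq, Submodule.map_span,
      Set.image_singleton]
  rw [hmap] at e
  have hv0 : p.mkQ v ≠ 0 := by simpa using hv
  refine ⟨⟨fun h => Module.Finite.equiv e, fun h => ?_⟩, fun h => ?_⟩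
  · have := Module.Finite.equiv e.symm
    exact Module.Finite.of_submodule_quotient (F ∙ (p.mkQ v))
  · rw [← e.finrank_eq, ← finrank_span_singleton (K := F) hv0,
      Submodule.finrank_quotient_add_finrank]

end LinearAlgebra

section Curve

variable {F L : Type*} [Field F] [Field L] [Algebra F L]

theorem mem_H0_iff {E : Place F L → ℤ} {f : L} :
    f ∈ H0 E ↔ ∀ x : Place F L, ((-E x : ℤ) : WithTop ℤ) ≤ x.ord f := Iff.rfl

theorem mem_H0_iff_val {E : Place F L → ℤ} {f : L} (hf : f ≠ 0) :
    f ∈ H0 E ↔ ∀ x : Place F L, -E x ≤ x.val f :=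
  forall_congr' fun x => x.coe_le_ord_iff hf

theorem H0_mono {E E' : Place F L → ℤ} (h : E ≤ E') : H0 E ≤ H0 E' := fun _ hf x =>
  le_trans (WithTop.coe_le_coe.mpr (neg_le_neg (h x))) (hf x)

/-- The denominator of `H1 A`: sums of a repartition with poles bounded by `A` and of a function. -/
abbrev boundaries (A : Divisor F L) : Submodule F (repartitions F L) :=
  (repartitionsLE A ⊔ principalRepartitions F L).submoduleOf (repartitions F L)

theorem mem_boundaries_iff {A : Divisor F L} {r : repartitions F L} :
    r ∈ boundaries A ↔ ∃ f : L, ∀ x, ((-A x : ℤ) : WithTop ℤ) ≤ x.ord (r.1 x - f) := by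
  rw [boundaries, Submodule.submoduleOf, Submodule.mem_comap, Submodule.mem_sup]
  constructor
  · rintro ⟨s, hs, _, ⟨f, rfl⟩, h⟩
    refine ⟨f, fun x => ?_⟩
    have : r.1 x - f = s x := by
      rw [← Submodule.subtype_apply, ← h]; simp
    rw [this]
    exact hs x
  · rintro ⟨f, hf⟩
    exact ⟨fun x => r.1 x - f, hf, _, ⟨f, rfl⟩, by ext x; simp⟩

theorem boundaries_mono {A B : Divisor F L} (h : A ≤ B) : boundaries A ≤ boundaries B := by
  intro r hr
  obtain ⟨f, hf⟩ := mem_boundaries_iff.mp hr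
  exact mem_boundaries_iff.mpr ⟨f, fun x =>
    le_trans (WithTop.coe_le_coe.mpr (neg_le_neg (h x))) (hf x)⟩

open Classical in
theorem single_mem_repartitions (x : Place F L) (f : L) : Pi.single x f ∈ repartitions F L := by
  refine (Set.finite_singleton x).subset fun y hy => ?_
  by_contra h
  simp only [Set.mem_singleton_iff] at h
  simp [h] at hy

theorem mem_H0_add_single_iff {A : Divisor F L} {x : Place F L} {f : L} :
    f ∈ H0 (A + Finsupp.single x 1 : Divisor F L) ↔ ((-A x - 1 : ℤ) : WithTop ℤ) ≤ x.ord f ∧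
      ∀ y ≠ x, ((-A y : ℤ) : WithTop ℤ) ≤ y.ord f := by
  classical
  rw [mem_H0_iff]
  constructor
  · intro h
    refine ⟨?_, fun y hy => ?_⟩
    · have := h x
      rwa [Finsupp.add_apply, Finsupp.single_eq_same, neg_add, ← sub_eq_add_neg] at this
    · have := h y
      rwa [Finsupp.add_apply, Finsupp.single_eq_of_ne hy, add_zero] at this
  · rintro ⟨h1, h2⟩ y
    by_cases hy : y = x
    · subst hy
      rwa [Finsupp.add_apply, Finsupp.single_eq_same, neg_add, ← sub_eq_add_neg]
    · rw [Finsupp.add_apply, Finsupp.single_eq_of_ne hy, add_zero]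
      exact h2 y hy

theorem ord_eq_of_mem_of_notMem {A : Divisor F L} {x : Place F L} {g : L}
    (hg : g ∈ H0 (A + Finsupp.single x 1 : Divisor F L)) (hg' : g ∉ H0 ⇑A) :
    x.ord g = ((-A x - 1 : ℤ) : WithTop ℤ) := by
  rw [mem_H0_add_single_iff] at hg
  have hg0 : g ≠ 0 := by rintro rfl; exact hg' (Submodule.zero_mem _)
  have h1 := (x.coe_le_ord_iff hg0).mp hg.1
  have h2 : ¬ -A x ≤ x.val g := by
    intro h
    refine hg' fun y => ?_
    by_cases hy : y = x
    · subst hy; exact (y.coe_le_ord_iff hg0).mpr h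
    · exact hg.2 y hy
  rw [← x.coe_val hg0, WithTop.coe_eq_coe]
  omega

theorem Place.exists_ord_eq (x : Place F L) (n : ℤ) : ∃ t : L, x.ord t = n := by
  obtain ⟨t, h0, ht⟩ := x.exists_val_eq n
  exact ⟨t, by rw [← x.coe_val h0, ht]⟩

theorem H0_eq_or_exists (A : Divisor F L) (x : Place F L) :
    H0 (A + Finsupp.single x 1 : Divisor F L) = H0 ⇑A ∨
      ∃ g ∈ H0 (A + Finsupp.single x 1 : Divisor F L), g ∉ H0 ⇑A := by
  by_cases h : ∃ g ∈ H0 (A + Finsupp.single x 1 : Divisor F L), g ∉ H0 ⇑A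
  · exact Or.inr h
  · push Not at h
    have : A ≤ A + Finsupp.single x 1 := le_add_of_nonneg_right (by simp)
    exact Or.inl (le_antisymm h (H0_mono this))

variable [IsAlgClosed F] [IsFunctionFieldOne F L]

/-- Modulo functions of larger order at `x`, two functions of order at least `n` at `x`, the second
of order exactly `n`, are proportional. -/
theorem Place.exists_le_ord_sub_smul (x : Place F L) {n : ℤ} {f g : L}
    (hf : (n : WithTop ℤ) ≤ x.ord f) (hg : x.ord g = n) :
    ∃ c : F, ((n + 1 : ℤ) : WithTop ℤ) ≤ x.ord (f - c • g) := by
  have hg0 := x.ne_zero_of_ord_eq hg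
  by_cases hf0 : f = 0
  · exact ⟨0, by simp [hf0]⟩
  rw [x.coe_le_ord_iff hf0] at hf
  have hg' := x.val_eq_of_ord_eq hg
  obtain ⟨c, hc⟩ := x.exists_residue (f := f * g⁻¹) (by
    have h0 : f * g⁻¹ ≠ 0 := mul_ne_zero hf0 (inv_ne_zero hg0)
    rw [← WithTop.coe_zero, x.coe_le_ord_iff h0, x.val_mul hf0 (inv_ne_zero hg0), x.val_inv]
    omega)
  refine ⟨c, ?_⟩
  have h1 : f - c • g = (f * g⁻¹ - algebraMap F L c) * g := by
    rw [Algebra.smul_def]; field_simp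
  by_cases h0 : f * g⁻¹ - algebraMap F L c = 0
  · rw [h1, h0]; simp
  · rw [← WithTop.coe_zero, ← x.coe_val h0, WithTop.coe_lt_coe] at hc
    rw [h1, x.coe_le_ord_iff (mul_ne_zero h0 hg0), x.val_mul h0 hg0]
    omega

theorem H0_add_single_eq {A : Divisor F L} {x : Place F L} {g : L}
    (hg : g ∈ H0 (A + Finsupp.single x 1 : Divisor F L)) (hg' : g ∉ H0 ⇑A) :
    H0 (A + Finsupp.single x 1 : Divisor F L) = H0 ⇑A ⊔ F ∙ g := by
  refine le_antisymm (fun f hf => ?_) (sup_le (H0_mono ?_) ?_)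
  · have hg1 := mem_H0_add_single_iff.mp hg
    have hf1 := mem_H0_add_single_iff.mp hf
    obtain ⟨c, hc⟩ := x.exists_le_ord_sub_smul hf1.1 (ord_eq_of_mem_of_notMem hg hg')
    rw [Submodule.mem_sup]
    refine ⟨f - c • g, fun y => ?_, c • g,
      Submodule.smul_mem _ _ (Submodule.mem_span_singleton_self g), sub_add_cancel _ _⟩
    by_cases hy : y = x
    · subst hy; simpa using hc
    · exact y.ord.map_le_sub (hf1.2 y hy) (y.le_ord_smul c (hg1.2 y hy))
  · have : A ≤ A + Finsupp.single x 1 := le_add_of_nonneg_right (by simp)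
    exact this
  · rwa [Submodule.span_singleton_le_iff_mem]

open Classical in
/-- Allowing one more pole at `x` enlarges the denominator of `H¹` by the repartition concentrated
at `x`. -/
theorem boundaries_add_single_eq (A : Divisor F L) (x : Place F L) {t : L}
    (ht : x.ord t = ((-A x - 1 : ℤ) : WithTop ℤ)) :
    boundaries (A + Finsupp.single x 1) =
      boundaries A ⊔ F ∙ (⟨Pi.single x t, single_mem_repartitions x t⟩ : repartitions F L) := by
  refine le_antisymm (fun r hr => ?_) (sup_le (boundaries_mono ?_) ?_)
  · obtain ⟨f, hf⟩ := mem_boundaries_iff.mp hr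
    have hfx := hf x
    rw [Finsupp.add_apply, Finsupp.single_eq_same, neg_add, ← sub_eq_add_neg] at hfx
    obtain ⟨c, hc⟩ := x.exists_le_ord_sub_smul hfx ht
    rw [Submodule.mem_sup]
    refine ⟨r - c • ⟨Pi.single x t, single_mem_repartitions x t⟩,
      mem_boundaries_iff.mpr ⟨f, fun y => ?_⟩, _,
      Submodule.smul_mem _ c (Submodule.mem_span_singleton_self _), sub_add_cancel _ _⟩
    by_cases hy : y = x
    · subst hy
      simp only [Submodule.coe_sub, Submodule.coe_smul, Pi.sub_apply, Pi.smul_apply,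
        Pi.single_eq_same]
      rw [sub_right_comm]
      simpa using hc
    · have := hf y
      rw [Finsupp.add_apply, Finsupp.single_eq_of_ne hy, add_zero] at this
      simpa [Pi.single_eq_of_ne hy] using this
  · exact le_add_of_nonneg_right (by simp)
  · rw [Submodule.span_singleton_le_iff_mem, mem_boundaries_iff]
    refine ⟨0, fun y => ?_⟩
    by_cases hy : y = x
    · subst hy
      simp only [Pi.single_eq_same, sub_zero, ht]
      rw [Finsupp.add_apply, Finsupp.single_eq_same, neg_add, ← sub_eq_add_neg]
    · simp [Pi.single_eq_of_ne hy]

open Classical in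
/-- The repartition with a pole of order `A x + 1` concentrated at `x` is trivial in `H¹(O(A))`
exactly if that pole is attained by a function. -/
theorem single_mem_boundaries_iff (A : Divisor F L) (x : Place F L) {t : L}
    (ht : x.ord t = ((-A x - 1 : ℤ) : WithTop ℤ)) :
    (⟨Pi.single x t, single_mem_repartitions x t⟩ : repartitions F L) ∈ boundaries A ↔
      ∃ g ∈ H0 (A + Finsupp.single x 1 : Divisor F L), g ∉ H0 ⇑A := by
  rw [mem_boundaries_iff]
  constructor
  · rintro ⟨f, hf⟩
    have hx := hf x
    simp only [Pi.single_eq_same] at hx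
    have hlt : ¬ ((-A x : ℤ) : WithTop ℤ) ≤ x.ord t := by
      rw [ht, WithTop.coe_le_coe]; omega
    refine ⟨f, mem_H0_add_single_iff.mpr ⟨?_, fun y hy => ?_⟩, fun h => hlt ?_⟩
    · rw [← sub_sub_cancel t f]
      exact x.ord.map_le_sub ht.ge (le_trans (WithTop.coe_le_coe.mpr (by omega)) hx)
    · simpa [Pi.single_eq_of_ne hy, x.ord.map_neg] using hf y
    · rw [← sub_add_cancel t f]
      exact x.ord.map_le_add hx (h x)
  · rintro ⟨g, hg, hg'⟩
    have hgx := ord_eq_of_mem_of_notMem hg hg'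
    obtain ⟨c, hc⟩ := x.exists_le_ord_sub_smul ht.ge hgx
    refine ⟨c • g, fun y => ?_⟩
    by_cases hy : y = x
    · subst hy; simpa using hc
    · simpa [Pi.single_eq_of_ne hy, y.ord.map_neg] using
        y.le_ord_smul c ((mem_H0_add_single_iff.mp hg).2 y hy)

theorem finite_H0_add_single_iff (A : Divisor F L) (x : Place F L) :
    Module.Finite F (H0 ⇑A) ↔ Module.Finite F (H0 (A + Finsupp.single x 1 : Divisor F L)) := by
  rcases H0_eq_or_exists A x with h | ⟨g, hg, hg'⟩
  · rw [h]
  · constructor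
    · intro _
      rw [H0_add_single_eq hg hg']
      infer_instance
    · intro _
      have : A ≤ A + Finsupp.single x 1 := le_add_of_nonneg_right (by simp)
      exact Submodule.finiteDimensional_of_le (H0_mono this)

/-- Allowing one more pole at a point either enlarges `H⁰` by one dimension or makes `H¹` smaller by
one dimension. -/
theorem h1_add_single (A : Divisor F L) (x : Place F L) [Module.Finite F (H0 ⇑A)] :
    (Module.Finite F (H1 A) ↔ Module.Finite F (H1 (A + Finsupp.single x 1))) ∧
    (Module.Finite F (H1 A) →
      (Module.finrank F (H0 (A + Finsupp.single x 1 : Divisor F L)) : ℤ) -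
          Module.finrank F (H1 (A + Finsupp.single x 1)) =
        Module.finrank F (H0 ⇑A) - Module.finrank F (H1 A) + 1) := by
  classical
  obtain ⟨t, ht⟩ := x.exists_ord_eq (-A x - 1)
  have hb := boundaries_add_single_eq A x ht
  have hm := single_mem_boundaries_iff A x ht
  suffices h : (Module.Finite F (repartitions F L ⧸ boundaries A) ↔
      Module.Finite F (repartitions F L ⧸ boundaries (A + Finsupp.single x 1))) ∧
      (Module.Finite F (repartitions F L ⧸ boundaries A) →
        (Module.finrank F (H0 (A + Finsupp.single x 1 : Divisor F L)) : ℤ) -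
          Module.finrank F (repartitions F L ⧸ boundaries (A + Finsupp.single x 1)) =
        Module.finrank F (H0 ⇑A) - Module.finrank F (repartitions F L ⧸ boundaries A) + 1) from h
  rcases H0_eq_or_exists A x with h | ⟨g, hg, hg'⟩
  · have hnm := mt hm.mp (by rw [h]; push Not; exact fun g hg => hg)
    obtain ⟨h1, h2⟩ := Submodule.quotient_sup_span_singleton hnm
    rw [hb, h]
    refine ⟨h1, fun hfin => ?_⟩
    rw [h2 hfin]
    push_cast
    ring
  · have hb' : boundaries (A + Finsupp.single x 1) = boundaries A := by
      rw [hb, sup_eq_left, Submodule.span_singleton_le_iff_mem]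
      exact hm.mpr ⟨g, hg, hg'⟩
    rw [hb', H0_add_single_eq hg hg', Submodule.finrank_sup_span_singleton_of_notMem hg']
    refine ⟨Iff.rfl, fun _ => ?_⟩
    push_cast
    ring

end Curve

/-! ### Principal divisors and finiteness of cohomology -/

section RiemannRoch

variable {F L : Type*} [Field F] [Field L] [Algebra F L]

theorem transcendental_of_not_mem_range [IsAlgClosed F] {t : L}
    (ht : t ∉ Set.range (algebraMap F L)) : Transcendental F t := fun h =>
  ht (minpoly.mem_range_of_degree_eq_one F t
    (IsAlgClosed.degree_eq_one_of_irreducible F (minpoly.irreducible h.isIntegral)))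

theorem adjoin_simple_inv (t : L) : F⟮t⁻¹⟯ = F⟮t⟯ := by
  refine le_antisymm ?_ ?_ <;> rw [adjoin_simple_le_iff]
  · exact inv_mem (mem_adjoin_simple_self F t)
  · simpa using inv_mem (mem_adjoin_simple_self F t⁻¹)

variable [IsFunctionFieldOne F L]

/-- The divisor of the function `f`; it is zero for `f = 0`. -/
def principalDivisor (F : Type*) {L : Type*} [Field F] [Field L] [Algebra F L]
    [IsFunctionFieldOne F L] (f : L) : Divisor F L :=
  Finsupp.ofSupportFinite (fun x => x.val f) (Place.finite_val_ne_zero f)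

@[simp] theorem principalDivisor_apply (f : L) (x : Place F L) :
    principalDivisor F f x = x.val f := rfl

/-- The divisor of poles of the function `f`. -/
def poleDivisor (F : Type*) {L : Type*} [Field F] [Field L] [Algebra F L]
    [IsFunctionFieldOne F L] (f : L) : Divisor F L := -principalDivisor F f ⊔ 0

theorem poleDivisor_apply (f : L) (x : Place F L) :
    poleDivisor F f x = max (-x.val f) 0 := rfl

theorem poleDivisor_nonneg (f : L) : 0 ≤ poleDivisor F f := le_sup_right

theorem principalDivisor_eq_sub (f : L) :
    principalDivisor F f = poleDivisor F f⁻¹ - poleDivisor F f := by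
  ext x
  rw [Finsupp.sub_apply, poleDivisor_apply, poleDivisor_apply, principalDivisor_apply, x.val_inv]
  omega

theorem principal_mem_repartitions (f : L) :
    (fun _ => f) ∈ repartitions F L := by
  refine (Place.finite_val_ne_zero (F := F) f).subset fun x hx => ?_
  by_cases hf : f = 0
  · simp [hf] at hx
  · intro h
    exact hx ((x.coe_le_ord_iff hf).mpr h.ge)

theorem H0_add_principalDivisor_iff (A : Divisor F L) {z : L} (hz : z ≠ 0) (f : L) :
    f ∈ H0 (A + principalDivisor F z : Divisor F L) ↔ f * z ∈ H0 ⇑A := by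
  by_cases hf : f = 0
  · simp [hf]
  rw [mem_H0_iff_val hf, mem_H0_iff_val (mul_ne_zero hf hz)]
  refine forall_congr' fun x => ?_
  rw [x.val_mul hf hz, Finsupp.add_apply, principalDivisor_apply]
  omega

theorem finrank_H0_add_principalDivisor (A : Divisor F L) {z : L} (hz : z ≠ 0) :
    Module.finrank F (H0 (A + principalDivisor F z : Divisor F L)) =
      Module.finrank F (H0 ⇑A) := by
  let e : L ≃ₗ[F] L :=
    { LinearMap.mulRight F z with
      invFun := fun f => f * z⁻¹
      left_inv := fun f => by simp [hz]
      right_inv := fun f => by simp [hz] }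
  have : (H0 (A + principalDivisor F z : Divisor F L)).map (e : L →ₗ[F] L) = H0 ⇑A := by
    ext f
    rw [Submodule.mem_map]
    constructor
    · rintro ⟨g, hg, rfl⟩
      exact (H0_add_principalDivisor_iff A hz g).mp hg
    · intro hf
      refine ⟨e.symm f, ?_, e.apply_symm_apply f⟩
      refine (H0_add_principalDivisor_iff A hz _).mpr ?_
      change e (e.symm f) ∈ _
      rwa [e.apply_symm_apply]
  rw [← this]
  exact (e.submoduleMap _).finrank_eq

theorem deg_poleDivisor_le {t : L} (ht : t ∉ Set.range (algebraMap F L)) :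
    deg ⇑(poleDivisor F t) ≤ Module.finrank F⟮t⟯ L := by
  have hti : t⁻¹ ∉ Set.range (algebraMap F L) := by
    rintro ⟨c, hc⟩
    exact ht ⟨c⁻¹, by rw [map_inv₀, hc, inv_inv]⟩
  have h := Place.sum_val_le_finrank hti (poleDivisor F t).support fun x hx => by
    rw [Finsupp.mem_support_iff, poleDivisor_apply] at hx
    rw [x.val_inv]
    omega
  rw [adjoin_simple_inv] at h
  refine le_trans (le_of_eq ?_) h
  rw [deg_coe_eq_sum, Finsupp.sum]
  refine Finset.sum_congr rfl fun x hx => ?_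
  rw [Finsupp.mem_support_iff, poleDivisor_apply] at hx
  rw [x.val_inv, poleDivisor_apply]
  omega

/-- Multiplication by a function on repartitions. -/
def mulRepartition (f : L) : repartitions F L →ₗ[F] repartitions F L :=
  (LinearMap.mulLeft F (fun _ : Place F L => f)).restrict fun r hr => by
    refine (Set.Finite.union hr (principal_mem_repartitions (F := F) f)).subset fun x hx => ?_
    by_contra h
    simp only [Set.mem_union, Set.mem_ofPred_eq, not_or, not_not] at h
    refine hx ?_
    change 0 ≤ x.ord (f * r x)
    rw [x.ord.map_mul]
    exact add_nonneg h.2 h.1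

theorem mulRepartition_apply (f : L) (r : repartitions F L) (x : Place F L) :
    (mulRepartition f r).1 x = f * r.1 x := rfl

theorem mulRepartition_mem_boundaries {A : Divisor F L} {f : L} (hf : f ∈ H0 ⇑A) :
    boundaries (0 : Divisor F L) ≤ (boundaries A).comap (mulRepartition f) := by
  intro r hr
  obtain ⟨g, hg⟩ := mem_boundaries_iff.mp hr
  refine mem_boundaries_iff.mpr ⟨f * g, fun x => ?_⟩
  rw [mulRepartition_apply, ← mul_sub, ← add_zero (-A x)]
  exact x.ord_mul_le (hf x) (by simpa using hg x)

variable [IsAlgClosed F]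

/-- Only the constants have no poles. -/
theorem H0_zero : H0 (⇑(0 : Divisor F L)) = F ∙ (1 : L) := by
  refine le_antisymm (fun f hf => ?_) ?_
  · rw [Submodule.mem_span_singleton]
    by_contra h
    have hfc : f ∉ Set.range (algebraMap F L) := by
      rintro ⟨c, rfl⟩
      exact h ⟨c, by rw [Algebra.smul_def, mul_one]⟩
    obtain ⟨x, hx⟩ := exists_val_neg hfc
    have hf0 : f ≠ 0 := by rintro rfl; exact hfc ⟨0, map_zero _⟩
    have := (mem_H0_iff_val hf0).mp hf x
    simp at this
    omega
  · rw [Submodule.span_singleton_le_iff_mem]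
    intro x
    simp

theorem finrank_H0_zero : Module.finrank F (H0 (⇑(0 : Divisor F L))) = 1 := by
  rw [H0_zero, finrank_span_singleton one_ne_zero]

instance finite_H0 (A : Divisor F L) : Module.Finite F (H0 ⇑A) := by
  refine (Divisor.iff_of_forall_add_single
    (P := fun A => Module.Finite F (H0 ⇑A)) finite_H0_add_single_iff A 0).mpr ?_
  rw [H0_zero]
  infer_instance

theorem finrank_H0_add_single_le (A : Divisor F L) (x : Place F L) :
    Module.finrank F (H0 (A + Finsupp.single x 1 : Divisor F L)) ≤
      Module.finrank F (H0 ⇑A) + 1 := by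
  rcases H0_eq_or_exists A x with h | ⟨g, hg, hg'⟩
  · rw [h]; omega
  · rw [H0_add_single_eq hg hg', Submodule.finrank_sup_span_singleton_of_notMem hg']

theorem finrank_H0_le_add {A B : Divisor F L} (h : A ≤ B) :
    (Module.finrank F (H0 ⇑B) : ℤ) ≤ Module.finrank F (H0 ⇑A) + (deg ⇑B - deg ⇑A) := by
  refine Divisor.le_induction h (P := fun C => (Module.finrank F (H0 ⇑C) : ℤ) ≤
    Module.finrank F (H0 ⇑A) + (deg ⇑C - deg ⇑A)) (by simp) fun C x _ hC => ?_
  have := finrank_H0_add_single_le C x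
  rw [deg_coe_add, deg_single]
  omega

/-- With a basis `u` of `L` over `F(t)`, the products `t ^ j * u i` for `j ≤ l` are independent
functions with poles bounded by `l` times the poles of `t` and a fixed divisor. -/
theorem exists_le_finrank_H0_nsmul_poleDivisor {t : L} (ht : t ∉ Set.range (algebraMap F L)) :
    ∃ C : ℤ, ∀ l : ℕ, (Module.finrank F⟮t⟯ L : ℤ) * (l + 1) - C ≤
      Module.finrank F (H0 ⇑(l • poleDivisor F t)) := by
  have hfin := IsFunctionFieldOne.finite_adjoin t ht
  have ht0 : t ≠ 0 := by rintro rfl; exact ht ⟨0, map_zero _⟩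
  let u := Module.finBasis F⟮t⟯ L
  let C : Divisor F L := ∑ i, poleDivisor F (u i)
  have hC : 0 ≤ C := Finset.sum_nonneg fun i _ => poleDivisor_nonneg _
  have hCu : ∀ i, poleDivisor F (u i) ≤ C := fun i =>
    Finset.single_le_sum (f := fun i => poleDivisor F (u i)) (fun i _ => poleDivisor_nonneg _)
      (Finset.mem_univ i)
  refine ⟨deg ⇑C, fun l => ?_⟩
  have h1 := finrank_H0_le_add (le_add_of_nonneg_right hC : l • poleDivisor F t ≤ _ + C)
  rw [deg_coe_add] at h1
  have hpow : LinearIndependent F fun j : Fin (l + 1) => (AdjoinSimple.gen F t) ^ (j : ℕ) := by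
    have h2 : Transcendental F (AdjoinSimple.gen F t) := by
      intro h
      exact transcendental_of_not_mem_range ht (by
        simpa using h.algebraMap (A := L))
    have h3 := (basisMonomials F).linearIndependent.map' (aeval (AdjoinSimple.gen F t)).toLinearMap
      (LinearMap.ker_eq_bot.mpr (transcendental_iff_injective.mp h2))
    have h4 := h3.comp (fun j : Fin (l + 1) => (j : ℕ)) Fin.val_injective
    convert! h4 with j
    simp [aeval_monomial]
  have hli := linearIndependent_smul hpow u.linearIndependent
  have hmem : ∀ p : Fin (l + 1) × Fin (Module.finrank F⟮t⟯ L),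
      (AdjoinSimple.gen F t) ^ (p.1 : ℕ) • u p.2 ∈ H0 (l • poleDivisor F t + C : Divisor F L) := by
    rintro ⟨j, i⟩
    have hu : u i ≠ 0 := u.ne_zero i
    have heq : (AdjoinSimple.gen F t) ^ (j : ℕ) • u i = t ^ (j : ℕ) * u i := by
      rw [Algebra.smul_def]; simp
    rw [heq, mem_H0_iff_val (mul_ne_zero (pow_ne_zero _ ht0) hu)]
    intro x
    have h5 := hCu i x
    rw [poleDivisor_apply] at h5
    rw [x.val_mul (pow_ne_zero _ ht0) hu, x.val_pow ht0, Finsupp.add_apply, Finsupp.smul_apply,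
      poleDivisor_apply, nsmul_eq_mul]
    have hj : (j : ℤ) ≤ l := by have := j.2; omega
    have h6 : -x.val t ≤ max (-x.val t) 0 := le_max_left _ _
    have h7 : 0 ≤ max (-x.val t) 0 := le_max_right _ _
    have h8 : -(u i |> x.val) ≤ C x := le_trans (le_max_left _ _) h5
    have : -((l : ℤ) * max (-x.val t) 0) ≤ j * x.val t := by nlinarith
    linarith
  have hli' : LinearIndependent F fun p =>
      (⟨_, hmem p⟩ : H0 (l • poleDivisor F t + C : Divisor F L)) :=
    LinearIndependent.of_comp (Submodule.subtype _) hli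
  have h9 := hli'.fintype_card_le_finrank
  rw [Fintype.card_prod, Fintype.card_fin, Fintype.card_fin] at h9
  have h10 : ((l : ℤ) + 1) * Module.finrank F⟮t⟯ L ≤
    Module.finrank F (H0 (l • poleDivisor F t + C : Divisor F L)) := by exact_mod_cast h9
  linarith

/-- The lower bound comes from comparing `h⁰(O(l (t)_∞))`, which grows like `l [L : F(t)]`, with its
upper bound `1 + l deg (t)_∞`. -/
theorem deg_poleDivisor {t : L} (ht : t ∉ Set.range (algebraMap F L)) :
    deg ⇑(poleDivisor F t) = Module.finrank F⟮t⟯ L := by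
  refine le_antisymm (deg_poleDivisor_le ht) ?_
  obtain ⟨C, hC⟩ := exists_le_finrank_H0_nsmul_poleDivisor ht
  by_contra! hlt
  have h1 : ∀ l : ℕ, (Module.finrank F⟮t⟯ L : ℤ) * (l + 1) - C ≤
      1 + l * deg ⇑(poleDivisor F t) := fun l => by
    refine (hC l).trans ?_
    have := finrank_H0_le_add (nsmul_nonneg (poleDivisor_nonneg t) l : 0 ≤ l • poleDivisor F t)
    rw [finrank_H0_zero, deg_nsmul, Finsupp.coe_zero, deg_zero, Nat.cast_one] at this
    linarith
  -- the slopes in `l` differ, so a large `l` gives a contradiction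
  have h2 := h1 (C + 1).toNat
  have h3 : C + 1 ≤ ((C + 1).toNat : ℤ) := Int.self_le_toNat _
  have h4 : (0 : ℤ) ≤ deg ⇑(poleDivisor F t) := deg_nonneg (poleDivisor_nonneg t)
  nlinarith

/-- A function has as many zeros as poles. -/
theorem deg_principalDivisor (f : L) : deg ⇑(principalDivisor F f) = 0 := by
  by_cases hf : f ∈ Set.range (algebraMap F L)
  · obtain ⟨c, rfl⟩ := hf
    have : principalDivisor F (algebraMap F L c) = 0 := by
      ext x; exact x.val_algebraMap c
    rw [this]; simp
  · have hfi : f⁻¹ ∉ Set.range (algebraMap F L) := by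
      rintro ⟨c, hc⟩
      exact hf ⟨c⁻¹, by rw [map_inv₀, hc, inv_inv]⟩
    rw [principalDivisor_eq_sub, deg_coe_sub, deg_poleDivisor hf, deg_poleDivisor hfi,
      adjoin_simple_inv, sub_self]

theorem H0_eq_bot_of_deg_neg {A : Divisor F L} (hA : deg ⇑A < 0) : H0 ⇑A = ⊥ := by
  rw [eq_bot_iff]
  intro f hf
  by_contra hf0
  have h : 0 ≤ principalDivisor F f + A := fun x => by
    have := (mem_H0_iff_val hf0).mp hf x
    rw [Finsupp.add_apply, principalDivisor_apply, Finsupp.coe_zero, Pi.zero_apply]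
    omega
  have := deg_nonneg h
  rw [deg_coe_add, deg_principalDivisor] at this
  omega

/-- Riemann's inequality, with an unspecified constant. -/
theorem exists_deg_sub_finrank_H0_le [Nonempty (Place F L)] :
    ∃ γ : ℤ, ∀ A : Divisor F L, deg ⇑A - Module.finrank F (H0 ⇑A) ≤ γ := by
  obtain ⟨x⟩ := ‹Nonempty (Place F L)›
  obtain ⟨t, -, htx⟩ := x.exists_val_eq_one
  have ht := x.not_mem_range_of_val_ne_zero (f := t) (by omega)
  have hfin := IsFunctionFieldOne.finite_adjoin t ht
  obtain ⟨C, hC⟩ := exists_le_finrank_H0_nsmul_poleDivisor ht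
  have hn : 0 < Module.finrank F⟮t⟯ L := Module.finrank_pos
  refine ⟨C, fun A => ?_⟩
  -- `A` is at most a divisor linearly equivalent to a large multiple of the poles of `t`
  let A' : Divisor F L := A ⊔ 0
  have hA' : A ≤ A' := le_sup_left
  have hA0 : 0 ≤ A' := le_sup_right
  let l : ℕ := (C + deg ⇑A').toNat
  have hl : C + deg ⇑A' ≤ l := Int.self_le_toNat _
  let B := l • poleDivisor F t
  have h1 := hC l
  have h2 := finrank_H0_le_add (sub_le_self B hA0)
  rw [deg_coe_sub] at h2
  have h3 : 0 < Module.finrank F (H0 (B - A' : Divisor F L)) := by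
    have : (0 : ℤ) < Module.finrank F (H0 (B - A' : Divisor F L)) := by nlinarith
    exact_mod_cast this
  obtain ⟨⟨z, hz⟩, hz0⟩ := Module.finrank_pos_iff_exists_ne_zero.mp h3
  have hz0 : z ≠ 0 := fun h => hz0 (Subtype.ext h)
  have hAz : A ≤ B + principalDivisor F z := by
    intro y
    have h4 := (mem_H0_iff_val hz0).mp hz y
    have h5 := hA' y
    rw [Finsupp.add_apply, principalDivisor_apply]
    rw [Finsupp.sub_apply] at h4
    omega
  have h6 := finrank_H0_le_add hAz
  rw [finrank_H0_add_principalDivisor B hz0, deg_coe_add, deg_principalDivisor, deg_nsmul,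
    deg_poleDivisor ht] at h6
  nlinarith

/-- `H¹(O(A)) = 0` for a divisor `A` with the largest value of `deg A - h⁰(O(A))`: adding points to
such a divisor must always enlarge `H⁰`, so it leaves `H¹` unchanged, and every class in `H¹` dies
once enough points are added. -/
theorem exists_boundaries_eq_top [Nonempty (Place F L)] :
    ∃ A : Divisor F L, boundaries A = ⊤ := by
  obtain ⟨γ, hγ⟩ := exists_deg_sub_finrank_H0_le (F := F) (L := L)
  obtain ⟨m, ⟨A, hA⟩, hmax⟩ := Int.exists_greatest_of_bdd
    (P := fun m => ∃ A : Divisor F L, deg ⇑A - Module.finrank F (H0 ⇑A) = m)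
    ⟨γ, by rintro _ ⟨A, rfl⟩; exact hγ A⟩ ⟨_, 0, rfl⟩
  refine ⟨A, eq_top_iff.mpr fun r _ => ?_⟩
  have key : ∀ B, A ≤ B → deg ⇑B - Module.finrank F (H0 ⇑B) = m ∧ boundaries B ≤ boundaries A := by
    intro B hB
    refine Divisor.le_induction hB (P := fun B => deg ⇑B - Module.finrank F (H0 ⇑B) = m ∧
      boundaries B ≤ boundaries A) ⟨hA, le_rfl⟩ ?_
    rintro B x hAB ⟨h1, h2⟩
    have h3 := hmax _ ⟨B + Finsupp.single x 1, rfl⟩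
    have hd : deg ⇑(B + Finsupp.single x 1 : Divisor F L) = deg ⇑B + 1 := by
      rw [deg_coe_add, deg_single]
    rw [hd] at h3 ⊢
    have h4 := finrank_H0_add_single_le B x
    refine ⟨by omega, le_trans (le_of_eq ?_) h2⟩
    obtain ⟨t, ht⟩ := x.exists_ord_eq (-B x - 1)
    classical
    rw [boundaries_add_single_eq B x ht, sup_eq_left, Submodule.span_singleton_le_iff_mem,
      single_mem_boundaries_iff B x ht]
    rcases H0_eq_or_exists B x with h | h
    · rw [h] at h3; omega
    · exact h
  -- the poles of `r` beyond `A`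
  let B : Divisor F L := A ⊔ Finsupp.ofSupportFinite (fun x => max (-x.val (r.1 x)) 0) (by
    refine Set.Finite.subset r.2 fun x hx h => hx ?_
    by_cases h0 : r.1 x = 0
    · simp [h0, Place.val]
    · have := (x.coe_le_ord_iff h0).mp h
      exact max_eq_right (by omega))
  refine (key B le_sup_left).2 (mem_boundaries_iff.mpr ⟨0, fun x => ?_⟩)
  rw [sub_zero]
  by_cases h0 : r.1 x = 0
  · simp [h0]
  · rw [x.coe_le_ord_iff h0]
    have h1 : max (-x.val (r.1 x)) 0 ≤ B x := le_sup_right (a := A x)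
    have := le_max_left (-x.val (r.1 x)) 0
    omega

instance finite_H1 [Nonempty (Place F L)] (A : Divisor F L) : Module.Finite F (H1 A) := by
  obtain ⟨B, hB⟩ := exists_boundaries_eq_top (F := F) (L := L)
  refine (Divisor.iff_of_forall_add_single (P := fun A => Module.Finite F (H1 A))
    (fun A x => (h1_add_single A x).1) A B).mpr ?_
  have : Subsingleton (H1 B) := Submodule.Quotient.subsingleton_iff.mpr hB
  infer_instance

end RiemannRoch

/-! ### The Riemann–Roch formula -/

section RiemannRoch

variable {F L : Type*} [Field F] [Field L] [Algebra F L] [IsFunctionFieldOne F L]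

/-- Multiplication by `f ∈ H⁰(O(A))` as a map from `H¹(O)` to `H¹(O(A))`. -/
def mulH1 (A : Divisor F L) (f : H0 ⇑A) : H1 (0 : Divisor F L) →ₗ[F] H1 A :=
  (boundaries (0 : Divisor F L)).liftQ ((boundaries A).mkQ ∘ₗ mulRepartition (f : L)) (by
    intro r hr
    rw [LinearMap.mem_ker, LinearMap.comp_apply, Submodule.mkQ_apply,
      Submodule.Quotient.mk_eq_zero]
    exact mulRepartition_mem_boundaries f.2 hr)

theorem mulH1_mk (A : Divisor F L) (f : H0 ⇑A) (r : repartitions F L) :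
    mulH1 A f ((boundaries (0 : Divisor F L)).mkQ r) = (boundaries A).mkQ
      (mulRepartition (f : L) r) := rfl

/-- The pairing `f ↦ (r ↦ ℓ(f r))` of a linear form `ℓ` on `H¹(O(A))`. -/
def dualPairing (A : Divisor F L) (ℓ : Module.Dual F (H1 A)) :
    H0 ⇑A →ₗ[F] Module.Dual F (H1 (0 : Divisor F L)) where
  toFun f := ℓ ∘ₗ mulH1 A f
  map_add' f g := by
    refine LinearMap.ext fun r => ?_
    obtain ⟨r, rfl⟩ := (boundaries (0 : Divisor F L)).mkQ_surjective r
    rw [LinearMap.comp_apply, LinearMap.add_apply, LinearMap.comp_apply, LinearMap.comp_apply,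
      mulH1_mk, mulH1_mk, mulH1_mk]
    rw [← map_add, ← map_add]
    congr 2
    ext x
    exact add_mul _ _ _
  map_smul' c f := by
    refine LinearMap.ext fun r => ?_
    obtain ⟨r, rfl⟩ := (boundaries (0 : Divisor F L)).mkQ_surjective r
    rw [RingHom.id_apply, LinearMap.smul_apply, LinearMap.comp_apply, LinearMap.comp_apply,
      mulH1_mk, mulH1_mk]
    rw [← map_smul, ← map_smul]
    congr 2
    ext x
    exact smul_mul_assoc _ _ _

variable [IsAlgClosed F]

/-- The Riemann–Roch formula with `H¹` in place of differentials. -/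
theorem finrank_H0_sub_finrank_H1 [Nonempty (Place F L)] (A : Divisor F L) :
    (Module.finrank F (H0 ⇑A) : ℤ) - Module.finrank F (H1 A) = deg ⇑A + 1 - genus F L := by
  refine (Divisor.iff_of_forall_add_single (P := fun A : Divisor F L =>
    (Module.finrank F (H0 ⇑A) : ℤ) - Module.finrank F (H1 A) = deg ⇑A + 1 - genus F L)
    (fun A x => ?_) A 0).mpr ?_
  · have h := (h1_add_single A x).2 (finite_H1 A)
    have hd : deg ⇑(A + Finsupp.single x 1 : Divisor F L) = deg ⇑A + 1 := by
      rw [deg_coe_add, deg_single]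
    constructor <;> intro h <;> linarith
  · have h1 : genus F L = Module.finrank F (H1 (0 : Divisor F L)) := rfl
    have h2 : deg ⇑(0 : Divisor F L) = 0 := by rw [Finsupp.coe_zero, deg_zero]
    have h3 := finrank_H0_zero (F := F) (L := L)
    omega

/-- If `H¹(O(A)) ≠ 0`, then `h⁰(O(A)) ≤ g`: a nonzero linear form `ℓ` on `H¹(O(A))` gives an
injection `f ↦ ℓ(f ·)` of `H⁰(O(A))` into the dual of `H¹(O)`. -/
theorem finrank_H0_le_genus [Nonempty (Place F L)] {A : Divisor F L}
    (hA : 0 < Module.finrank F (H1 A)) : Module.finrank F (H0 ⇑A) ≤ genus F L := by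
  obtain ⟨v, hv⟩ := Module.finrank_pos_iff_exists_ne_zero.mp hA
  obtain ⟨ℓ, hℓ⟩ : ∃ ℓ : Module.Dual F (H1 A), ℓ v ≠ 0 := by
    by_contra! h
    exact hv ((Module.forall_dual_apply_eq_zero_iff F v).mp h)
  obtain ⟨s, rfl⟩ := (boundaries A).mkQ_surjective v
  have hinj : Function.Injective (dualPairing A ℓ) := by
    rw [injective_iff_map_eq_zero]
    intro f hf
    by_contra hf0
    have hf0 : (f : L) ≠ 0 := fun h => hf0 (Subtype.ext h)
    refine hℓ ?_
    have h : ℓ (mulH1 A f ((boundaries (0 : Divisor F L)).mkQ (mulRepartition (f : L)⁻¹ s))) = 0 :=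
      LinearMap.congr_fun hf _
    rw [mulH1_mk] at h
    rw [← h]
    congr 2
    ext x
    rw [mulRepartition_apply, mulRepartition_apply, mul_inv_cancel_left₀ hf0]
  have h := LinearMap.finrank_le_finrank_of_injective hinj
  rwa [Subspace.dual_finrank_eq] at h

/-- In degree at least `2 g - 1`, a nonzero `H¹(O(A))` would make `h⁰(O(A))` exceed `g`. -/
theorem finrank_H1_eq_zero [Nonempty (Place F L)] {A : Divisor F L}
    (hA : 2 * (genus F L : ℤ) - 1 ≤ deg ⇑A) : Module.finrank F (H1 A) = 0 := by
  by_contra h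
  have h1 := finrank_H0_le_genus (Nat.pos_of_ne_zero h)
  have h2 := finrank_H0_sub_finrank_H1 A
  omega

end RiemannRoch

end CurveTheory

/-! ### Lang's theorem for Frobenius-semilinear maps -/

section Lang

open Polynomial

variable {k W V : Type*} [Field k] [Fintype k] [Field W] [Algebra k W] [AddCommGroup V]
  [Module W V]

theorem mem_range_algebraMap_of_pow_card_eq {c : W} (hc : c ^ Fintype.card k = c) :
    c ∈ Set.range (algebraMap k W) := by
  classical
  -- the `q` elements of `k` are already all the roots of `X ^ q - X`
  have hp : (X ^ Fintype.card k - X : W[X]) ≠ 0 :=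
    FiniteField.X_pow_card_sub_X_ne_zero W Fintype.one_lt_card
  have hsub : Finset.univ.image (algebraMap k W) ⊆
      (X ^ Fintype.card k - X : W[X]).roots.toFinset := by
    intro w hw
    obtain ⟨a, -, rfl⟩ := Finset.mem_image.mp hw
    rw [Multiset.mem_toFinset, mem_roots hp, IsRoot, eval_sub, eval_pow, eval_X, ← map_pow,
      FiniteField.pow_card, sub_self]
  have hcard : (X ^ Fintype.card k - X : W[X]).roots.toFinset.card ≤
      (Finset.univ.image (algebraMap k W)).card := by
    rw [Finset.card_image_of_injective _ (algebraMap k W).injective, Finset.card_univ]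
    exact (Multiset.toFinset_card_le _).trans ((card_roots' _).trans
      (FiniteField.X_pow_card_sub_X_natDegree_eq W Fintype.one_lt_card).le)
  have hc' : c ∈ (X ^ Fintype.card k - X : W[X]).roots.toFinset := by
    rw [Multiset.mem_toFinset, mem_roots hp, IsRoot, eval_sub, eval_pow, eval_X, hc, sub_self]
  rw [← Finset.eq_of_subset_of_card_le hsub hcard] at hc'
  obtain ⟨a, -, ha⟩ := Finset.mem_image.mp hc'
  exact ⟨a, ha⟩

/-- Fixed vectors of a Frobenius-semilinear map that are independent over `k` are independent
over `W`. -/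
theorem linearIndependent_of_fixed [Module k V] [IsScalarTower k W V] (φ : V →+ V)
    (hφ : ∀ (c : W) (v : V), φ (c • v) = c ^ Fintype.card k • φ v) {ι : Type*} {b : ι → V}
    (hb : LinearIndependent k b) (hfix : ∀ i, φ (b i) = b i) : LinearIndependent W b := by
  classical
  rw [linearIndependent_iff']
  intro s
  induction s using Finset.induction_on with
  | empty => simp
  | insert a s ha ih =>
    intro g hg
    rw [Finset.sum_insert ha] at hg
    suffices hga : g a = 0 by
      rw [hga, zero_smul, zero_add] at hg
      intro i hi
      rcases Finset.mem_insert.mp hi with rfl | hi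
      exacts [hga, ih g hg i hi]
    by_contra hga
    -- after normalization the coefficients are fixed by Frobenius, so they lie in `k`
    let h : ι → W := fun i => (g a)⁻¹ * g i
    have h1 : b a + ∑ i ∈ s, h i • b i = 0 := by
      have := congrArg ((g a)⁻¹ • ·) hg
      simpa only [smul_add, smul_smul, inv_mul_cancel₀ hga, one_smul, Finset.smul_sum,
        smul_zero] using this
    have h2 : b a + ∑ i ∈ s, h i ^ Fintype.card k • b i = 0 := by
      have := congrArg φ h1
      simpa only [map_add, map_sum, hφ, hfix, map_zero] using this
    have h3 : ∑ i ∈ s, (h i ^ Fintype.card k - h i) • b i = 0 := by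
      simp only [sub_smul, Finset.sum_sub_distrib]
      rw [eq_neg_of_add_eq_zero_right h1, eq_neg_of_add_eq_zero_right h2, sub_self]
    have h4 : ∀ i ∈ s, ∃ c : k, algebraMap k W c = h i := fun i hi =>
      mem_range_algebraMap_of_pow_card_eq (sub_eq_zero.mp (ih _ h3 i hi))
    choose! c hc using h4
    have h5 : ∑ i ∈ insert a s, (if i = a then 1 else c i) • b i = 0 := by
      rw [Finset.sum_insert ha, if_pos rfl, one_smul, ← h1]
      congr 1
      refine Finset.sum_congr rfl fun i hi => ?_
      rw [if_neg (by rintro rfl; exact ha hi), ← hc i hi, algebraMap_smul]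
    have := linearIndependent_iff'.mp hb _ _ h5 a (Finset.mem_insert_self a s)
    simp at this

/-- The polynomials `P_i` with `P_0 = a_0 Y^q` and `P_{i+1} = P_i^q + a_{i+1} Y^q`. If
`φ^(n+1) v = ∑ a_i φ^i v`, the sum over `i ≤ n`, then `∑ P_i(y) φ^i v` is fixed by `φ` as soon as
`P_n(y) = y`. -/
def langPoly (q : ℕ) (a : ℕ → W) : ℕ → W[X]
  | 0 => C (a 0) * X ^ q
  | i + 1 => langPoly q a i ^ q + C (a (i + 1)) * X ^ q

/-- `P_n` has no linear term, so that `P_n - Y` has a nonzero root unless `P_n = 0`. -/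
theorem X_sq_dvd_langPoly {q : ℕ} (hq : 2 ≤ q) (a : ℕ → W) (i : ℕ) : X ^ 2 ∣ langPoly q a i := by
  have hX : ∀ c : W, (X : W[X]) ^ 2 ∣ C c * X ^ q := fun c =>
    Dvd.dvd.mul_left (pow_dvd_pow X hq) _
  induction i with
  | zero => exact hX _
  | succ i ih => exact dvd_add (ih.trans (dvd_pow_self _ (by omega))) (hX _)

theorem langPoly_ne_zero {q : ℕ} (hq : 2 ≤ q) (a : ℕ → W) {n j : ℕ} (hj : j ≤ n) (ha : a j ≠ 0) :
    langPoly q a n ≠ 0 := by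
  have hdeg : ∀ c : W, c ≠ 0 → (C c * X ^ q : W[X]).natDegree = q := fun c hc =>
    natDegree_C_mul_X_pow q c hc
  have key : ∀ i, ((∀ j ≤ i, a j = 0) ∧ langPoly q a i = 0) ∨ q ≤ (langPoly q a i).natDegree := by
    intro i
    induction i with
    | zero =>
      by_cases h : a 0 = 0
      · left; simp [langPoly, h]
      · right; rw [langPoly, hdeg _ h]
    | succ i ih =>
      rcases ih with ⟨h1, h2⟩ | h
      · by_cases h : a (i + 1) = 0
        · left
          refine ⟨fun j hj => ?_, by simp [langPoly, h2, h]; omega⟩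
          rcases Nat.le_succ_iff.mp hj with hj | rfl
          exacts [h1 j hj, h]
        · right
          rw [langPoly, h2, zero_pow (by omega), zero_add, hdeg _ h]
      · right
        have h3 : (C (a (i + 1)) * X ^ q : W[X]).natDegree ≤ q := natDegree_C_mul_X_pow_le _ _
        have h4 : q * 2 ≤ (langPoly q a i ^ q).natDegree := by
          rw [natDegree_pow]
          exact Nat.mul_le_mul_left q (hq.trans h)
        rw [langPoly, natDegree_add_eq_left_of_natDegree_lt (by omega)]
        omega
  intro h0
  rcases key n with ⟨h, -⟩ | h
  · exact ha (h j hj)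
  · rw [h0, natDegree_zero] at h
    omega

theorem exists_eval_langPoly_eq [IsAlgClosed W] {q : ℕ} (hq : 2 ≤ q) (a : ℕ → W)
    {n j : ℕ} (hj : j ≤ n) (ha : a j ≠ 0) : ∃ y : W, y ≠ 0 ∧ (langPoly q a n).eval y = y := by
  obtain ⟨g, hg⟩ := X_sq_dvd_langPoly hq a n
  have hg0 : g ≠ 0 := by
    rintro rfl
    exact langPoly_ne_zero hq a hj ha (by rw [hg, mul_zero])
  obtain ⟨y, hy⟩ := IsAlgClosed.exists_root (X * g - 1) (by
    have h1 : (X * g - 1 : W[X]).natDegree = g.natDegree + 1 := by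
      rw [← C_1, natDegree_sub_C, natDegree_X_mul hg0]
    intro h
    rw [natDegree, h, WithBot.unbotD_zero] at h1
    omega)
  rw [IsRoot, eval_sub, eval_mul, eval_X, eval_one, sub_eq_zero] at hy
  refine ⟨y, ?_, ?_⟩
  · rintro rfl
    simp at hy
  · rw [hg, eval_mul, eval_pow, eval_X, sq, mul_assoc, hy, mul_one]

/-- An injective Frobenius-semilinear map of a nonzero finite-dimensional space over an
algebraically closed field has a nonzero fixed vector. -/
theorem exists_fixed_ne_zero [IsAlgClosed W] [Module.Finite W V] [Nontrivial V] {q : ℕ}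
    (hq : 2 ≤ q) (φ : V →+ V) (hφ : ∀ (c : W) (v : V), φ (c • v) = c ^ q • φ v)
    (hinj : Function.Injective φ) : ∃ v : V, v ≠ 0 ∧ φ v = v := by
  obtain ⟨v, hv⟩ := exists_ne (0 : V)
  have hex : ∃ N, ¬ LinearIndependent W fun i : Fin N => φ^[i] v :=
    ⟨Module.finrank W V + 1, fun h => by simpa using h.fintype_card_le_finrank⟩
  classical
  obtain ⟨n, hn⟩ : ∃ n, Nat.find hex = n + 2 := by
    have h0 : Nat.find hex ≠ 0 := by
      intro h
      have := Nat.find_spec hex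
      rw [h] at this
      exact this (linearIndependent_empty_type)
    have h1 : Nat.find hex ≠ 1 := by
      intro h
      have := Nat.find_spec hex
      rw [h] at this
      exact this (linearIndependent_unique_iff.mpr (by simpa using hv))
    exact ⟨Nat.find hex - 2, by omega⟩
  have hli : LinearIndependent W fun i : Fin (n + 1) => φ^[i] v := by
    by_contra h
    exact Nat.find_min hex (m := n + 1) (by omega) h
  have hdep := Nat.find_spec hex
  rw [hn] at hdep
  have hmem : φ^[n + 1] v ∈ Submodule.span W (Set.range fun i : Fin (n + 1) => φ^[i] v) := by
    by_contra h
    refine hdep ?_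
    have h1 := linearIndependent_finSnoc.mpr ⟨hli, h⟩
    convert h1 with i
    refine Fin.lastCases ?_ (fun i => ?_) i <;> simp
  obtain ⟨c, hc⟩ := (Submodule.mem_span_range_iff_exists_fun W).mp hmem
  let a : ℕ → W := fun i => if h : i < n + 1 then c ⟨i, h⟩ else 0
  have ha : ∑ i ∈ Finset.range (n + 1), a i • φ^[i] v = φ^[n + 1] v := by
    rw [← hc, Finset.sum_range]
    refine Finset.sum_congr rfl fun i _ => ?_
    simp only [a, dif_pos i.2]
  obtain ⟨j, hj, haj⟩ : ∃ j ≤ n, a j ≠ 0 := by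
    by_contra! h
    have h1 : φ^[n + 1] v = 0 := by
      rw [← ha]
      refine Finset.sum_eq_zero fun i hi => ?_
      rw [h i (by simpa [Nat.lt_succ_iff] using hi), zero_smul]
    have h2 : φ^[n + 1] (0 : V) = 0 := Function.iterate_fixed (map_zero φ) _
    exact hv (hinj.iterate (n + 1) (h1.trans h2.symm))
  obtain ⟨y, hy0, hy⟩ := exists_eval_langPoly_eq hq a hj haj
  refine ⟨∑ i ∈ Finset.range (n + 1), (langPoly q a i).eval y • φ^[i] v, fun h => ?_, ?_⟩
  · rw [Finset.sum_range] at h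
    have := Fintype.linearIndependent_iff.mp hli _ h (Fin.last n)
    simp [hy, hy0] at this
  · rw [map_sum]
    simp only [hφ, ← Function.iterate_succ_apply' (⇑φ)]
    rw [Finset.sum_range_succ, hy, ← ha, Finset.sum_range_succ', Finset.sum_range_succ' (n := n),
      smul_add, Finset.smul_sum, ← add_assoc, ← Finset.sum_add_distrib]
    simp only [smul_smul, langPoly, eval_add, eval_mul, eval_pow, eval_C, eval_X, add_smul,
      mul_comm]

/-- Lang's theorem for semilinear maps: the fixed vectors of an injective Frobenius-semilinear map
of a finite-dimensional space over an algebraically closed field span the space. -/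
theorem span_fixed_eq_top [IsAlgClosed W] [Module.Finite W V] {q : ℕ} (hq : 2 ≤ q) (φ : V →+ V)
    (hφ : ∀ (c : W) (v : V), φ (c • v) = c ^ q • φ v) (hinj : Function.Injective φ) :
    Submodule.span W {v | φ v = v} = ⊤ := by
  set S := Submodule.span W {v : V | φ v = v}
  have hroot : ∀ c : W, ∃ b, b ^ q = c := fun c => IsAlgClosed.exists_pow_nat_eq c (by omega)
  have hmaps : ∀ s ∈ S, φ s ∈ S := by
    intro s hs
    induction hs using Submodule.span_induction with
    | mem v hv => rw [Set.mem_ofPred_eq] at hv; rw [hv]; exact Submodule.subset_span hv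
    | zero => rw [map_zero]; exact S.zero_mem
    | add u v _ _ hu hv => rw [map_add]; exact S.add_mem hu hv
    | smul c v _ hv => rw [hφ]; exact S.smul_mem _ hv
  have hsurj : ∀ s ∈ S, ∃ u ∈ S, φ u = s := by
    intro s hs
    induction hs using Submodule.span_induction with
    | mem v hv => exact ⟨v, Submodule.subset_span hv, hv⟩
    | zero => exact ⟨0, S.zero_mem, map_zero φ⟩
    | add u v _ _ hu hv =>
      obtain ⟨u', hu', rfl⟩ := hu
      obtain ⟨v', hv', rfl⟩ := hv
      exact ⟨u' + v', S.add_mem hu' hv', map_add φ _ _⟩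
    | smul c v _ hv =>
      obtain ⟨v', hv', rfl⟩ := hv
      obtain ⟨b, rfl⟩ := hroot c
      exact ⟨b • v', S.smul_mem b hv', hφ b v'⟩
  -- Artin–Schreier equations in `S` are solvable
  have hAS : ∀ s ∈ S, ∃ u ∈ S, φ u - u = s := by
    intro s hs
    induction hs using Submodule.closure_induction with
    | zero => exact ⟨0, S.zero_mem, by simp⟩
    | add u v _ _ hu hv =>
      obtain ⟨u', hu', rfl⟩ := hu
      obtain ⟨v', hv', rfl⟩ := hv
      exact ⟨u' + v', S.add_mem hu' hv', by rw [map_add]; abel⟩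
    | smul_mem c v hv =>
      obtain ⟨b, hb⟩ := IsAlgClosed.exists_root (X ^ q - X - C c) (by
        have h1 : (X ^ q - X - C c : W[X]).natDegree = q := by
          rw [natDegree_sub_C, FiniteField.X_pow_card_sub_X_natDegree_eq W (by omega)]
        intro h
        rw [natDegree, h, WithBot.unbotD_zero] at h1
        omega)
      rw [IsRoot, eval_sub, eval_sub, eval_pow, eval_X, eval_C, sub_eq_zero] at hb
      rw [Set.mem_ofPred_eq] at hv
      exact ⟨b • v, S.smul_mem b (Submodule.subset_span hv), by rw [hφ, hv, ← sub_smul, hb]⟩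
  -- otherwise `V ⧸ S` has a nonzero fixed vector; it lifts to a fixed vector of `V`, outside `S`
  by_contra hne
  have : Nontrivial (V ⧸ S) := Submodule.Quotient.nontrivial_iff.mpr hne
  let ψ : V ⧸ S →+ V ⧸ S := QuotientAddGroup.map S.toAddSubgroup S.toAddSubgroup φ hmaps
  have hψ : ∀ v, ψ (S.mkQ v) = S.mkQ (φ v) := fun v => rfl
  obtain ⟨u, hu0, hu⟩ := exists_fixed_ne_zero (W := W) hq ψ
    (fun c v => by
      obtain ⟨v, rfl⟩ := S.mkQ_surjective v
      rw [← map_smul, hψ, hψ, hφ, map_smul])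
    ((injective_iff_map_eq_zero ψ).mpr fun v hv => by
      obtain ⟨v, rfl⟩ := S.mkQ_surjective v
      rw [hψ, Submodule.mkQ_apply, Submodule.Quotient.mk_eq_zero] at hv
      obtain ⟨u, hu, huv⟩ := hsurj _ hv
      rw [← hinj huv]
      simpa using hu)
  obtain ⟨u, rfl⟩ := S.mkQ_surjective u
  rw [hψ, ← sub_eq_zero, ← map_sub, Submodule.mkQ_apply, Submodule.Quotient.mk_eq_zero] at hu
  obtain ⟨s, hs, hsu⟩ := hAS _ hu
  have hfix : u - s ∈ S := Submodule.subset_span (by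
    rw [Set.mem_ofPred_eq, map_sub]
    rw [sub_eq_sub_iff_add_eq_add]
    rw [sub_eq_sub_iff_add_eq_add] at hsu
    rw [add_comm u, hsu, add_comm])
  refine hu0 ?_
  rw [Submodule.mkQ_apply, Submodule.Quotient.mk_eq_zero]
  simpa using S.add_mem hfix hs

end Lang

/-- A `k`-subspace of a `W`-vector space is linearly disjoint from `W` if its `k`-independent
families are independent over `W`. -/
theorem injective_liftBaseChange_subtype {k W V : Type*} [Field k] [Field W] [Algebra k W]
    [AddCommGroup V] [Module W V] [Module k V] [IsScalarTower k W V] (Ψ : Submodule k V)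
    (h : ∀ b : Module.Basis.ofVectorSpaceIndex k Ψ → V, LinearIndependent k b →
      (∀ i, b i ∈ Ψ) → LinearIndependent W b) :
    Function.Injective (Ψ.subtype.liftBaseChange W) := by
  let b := Module.Basis.ofVectorSpace k Ψ
  have hb := h (fun i => b i) (b.linearIndependent.map' Ψ.subtype Ψ.ker_subtype) fun i => (b i).2
  have hb' : LinearIndependent W
      (Ψ.subtype.liftBaseChange W ∘ Algebra.TensorProduct.basis W b) := by
    convert! hb with i
    simp
  refine (injective_iff_map_eq_zero _).mpr fun z hz => ?_
  set B := Algebra.TensorProduct.basis W b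
  rw [← B.linearCombination_repr z, LinearMap.map_finsupp_linearCombination] at hz
  have := linearIndependent_iff.mp hb' _ hz
  rwa [map_eq_zero_iff _ B.repr.injective] at this

/-! ### The function field of the base change -/

section GeomFunctionField

open IntermediateField

/-- A finitely generated extension of transcendence degree at most one of an algebraically closed
field is finite over the subfield generated by any non-constant element. -/
theorem isFunctionFieldOne_of_trdeg_le_one {F L : Type*} [Field F] [Field L] [Algebra F L]
    [IsAlgClosed F] [Algebra.EssFiniteType F L] (h : Algebra.trdeg F L ≤ 1) :
    IsFunctionFieldOne F L := by
  refine ⟨fun t ht => ?_⟩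
  have hind : AlgebraicIndependent F (fun i : ({t} : Set L) => (i : L)) :=
    (algebraicIndependent_singleton_iff ⟨t, rfl⟩).mpr (transcendental_of_not_mem_range ht)
  have hbasis := hind.isTranscendenceBasis_of_trdeg_le_of_finite (by simpa using h)
  have halg := hbasis.isAlgebraic
  have hr : Set.range (fun i : ({t} : Set L) => (i : L)) = {t} := by simp
  rw [hr] at halg
  have hE : Algebra.IsAlgebraic F⟮t⟯ L := by
    refine ⟨fun a => ?_⟩
    refine (halg.isAlgebraic a).ringHom_of_comp_eq
      (Subalgebra.inclusion (algebra_adjoin_le_adjoin F {t})) (RingHom.id L)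
      (Subalgebra.inclusion_injective _) ?_
    ext; rfl
  have : Algebra.EssFiniteType F⟮t⟯ L := Algebra.EssFiniteType.of_comp F F⟮t⟯ L
  exact Algebra.finite_of_essFiniteType_of_isAlgebraic

variable {k K W : Type*} [Field k] [Field K] [Algebra k K] [Field W] [Algebra k W]

/-- Every element of `W ⊗ K` is algebraic over `W[t]` if `K` is algebraic over `k(t)`. -/
theorem trdeg_geomFunctionField_le_one [IsDomain (W ⊗[k] K)] (hK : Algebra.trdeg k K = 1) :
    Algebra.trdeg W (GeomFunctionField k K W) ≤ 1 := by
  obtain ⟨s, hs⟩ := exists_isTranscendenceBasis k K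
  have hcard := hs.cardinalMk_eq_trdeg
  rw [hK, Cardinal.mk_set_eq_one_iff] at hcard
  obtain ⟨t, rfl⟩ := hcard
  have halg := hs.isAlgebraic
  rw [Subtype.range_coe] at halg
  set τ := toGeom k K W t
  set R := Algebra.adjoin W {τ}
  have hmem : ∀ a ∈ Algebra.adjoin k {t}, toGeom k K W a ∈ R := by
    intro a ha
    induction ha using Algebra.adjoin_induction with
    | mem a ha =>
      rw [Set.mem_singleton_iff] at ha
      rw [ha]
      exact Algebra.subset_adjoin rfl
    | algebraMap c =>
      rw [AlgHom.commutes, IsScalarTower.algebraMap_apply k W]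
      exact R.algebraMap_mem _
    | add a b _ _ ha hb => rw [map_add]; exact R.add_mem ha hb
    | mul a b _ _ ha hb => rw [map_mul]; exact R.mul_mem ha hb
  let f : Algebra.adjoin k {t} →+* R :=
    ((toGeom k K W).toRingHom.comp (Algebra.adjoin k {t}).val.toRingHom).codRestrict R
      fun a => hmem a a.2
  have hK : ∀ a : K, IsAlgebraic R (toGeom k K W a) := fun a => by
    refine (halg.isAlgebraic a).ringHom_of_comp_eq f (toGeom k K W) ?_ ?_
    · intro a b hab
      have h := congrArg Subtype.val hab
      exact Subtype.ext ((toGeom k K W).toRingHom.injective h)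
    · ext; rfl
  have htens : ∀ z : W ⊗[k] K, IsAlgebraic R (algebraMap _ (GeomFunctionField k K W) z) := by
    intro z
    induction z using TensorProduct.induction_on with
    | zero => rw [map_zero]; exact isAlgebraic_zero
    | add y z hy hz => rw [map_add]; exact hy.add hz
    | tmul w a =>
      have : algebraMap _ (GeomFunctionField k K W) (w ⊗ₜ[k] a) =
          algebraMap R _ (algebraMap W R w) * toGeom k K W a := by
        rw [← IsScalarTower.algebraMap_apply, IsScalarTower.algebraMap_apply W (W ⊗[k] K)]
        change _ = _ * algebraMap (W ⊗[k] K) _ ((1 : W) ⊗ₜ[k] a)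
        rw [← map_mul]
        congr 1
        simp
      rw [this]
      exact isAlgebraic_algebraMap _ |>.mul (hK a)
  have hL : Algebra.IsAlgebraic R (GeomFunctionField k K W) := by
    refine ⟨fun z => ?_⟩
    obtain ⟨a, b, -, rfl⟩ := IsFractionRing.div_surjective (A := W ⊗[k] K) z
    rw [div_eq_mul_inv]
    exact (htens a).mul (htens b).inv
  exact (Algebra.IsAlgebraic.trdeg_le_cardinalMk W {τ}).trans (Cardinal.mk_singleton τ).le

theorem isFunctionFieldOne_geomFunctionField [IsAlgClosed W] [IsDomain (W ⊗[k] K)]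
    [Algebra.EssFiniteType k K] (hK : Algebra.trdeg k K = 1) :
    IsFunctionFieldOne W (GeomFunctionField k K W) := by
  have h1 : Algebra.EssFiniteType (W ⊗[k] K) (GeomFunctionField k K W) :=
    .of_isLocalization _ (nonZeroDivisors (W ⊗[k] K))
  have : Algebra.EssFiniteType W (GeomFunctionField k K W) := .comp W (W ⊗[k] K) _
  exact isFunctionFieldOne_of_trdeg_le_one (trdeg_geomFunctionField_le_one hK)

end GeomFunctionField

/-! ### Twists and pullbacks -/

section Twist

variable {k K W : Type*} [Field k] [Field K] [Algebra k K] [Field W] [Algebra k W]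

theorem conjFun_algebraMap_tensor (σ : W ≃ₐ[k] W) (z : W ⊗[k] K) :
    conjFun K σ (algebraMap (W ⊗[k] K) (GeomFunctionField k K W) z) =
      algebraMap (W ⊗[k] K) (GeomFunctionField k K W)
        (Algebra.TensorProduct.congr σ (AlgEquiv.refl : K ≃ₐ[k] K) z) :=
  IsLocalization.algEquivOfAlgEquiv_eq _ _

theorem twistFun_toGeom [Fintype k] [IsAlgClosed W] (n : ℤ) (f : K) :
    twistFun n (toGeom k K W f) = toGeom k K W f :=
  conjFun_toGeom _ f

theorem twistFun_smul [Fintype k] [IsAlgClosed W] (c : W) (f : GeomFunctionField k K W) :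
    twistFun 1 (c • f) = c ^ Fintype.card k • twistFun 1 f := by
  have h := conjFun_algebraMap (K := K) (frob k W ^ (1 : ℤ)) c
  rw [zpow_one, frob_apply] at h
  rw [Algebra.smul_def, Algebra.smul_def, ← h, twistFun, map_mul, twistFun, zpow_one]

variable [IsDomain (W ⊗[k] K)]

theorem conjFun_mul (σ τ : W ≃ₐ[k] W) (f : GeomFunctionField k K W) :
    conjFun K (σ * τ) f = conjFun K σ (conjFun K τ f) := by
  have h : ∀ z : W ⊗[k] K, Algebra.TensorProduct.congr (σ * τ) (AlgEquiv.refl : K ≃ₐ[k] K) z =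
      Algebra.TensorProduct.congr σ (AlgEquiv.refl : K ≃ₐ[k] K)
        (Algebra.TensorProduct.congr τ (AlgEquiv.refl : K ≃ₐ[k] K) z) := by
    intro z
    induction z using TensorProduct.induction_on with
    | zero => simp only [map_zero]
    | add y z hy hz => simp only [map_add, hy, hz]
    | tmul w a => rfl
  obtain ⟨a, b, -, rfl⟩ := IsFractionRing.div_surjective (A := W ⊗[k] K) f
  simp only [map_div₀, conjFun_algebraMap_tensor, h]

theorem conjFun_one (f : GeomFunctionField k K W) : conjFun K (1 : W ≃ₐ[k] W) f = f := by
  have h := conjFun_mul (1 : W ≃ₐ[k] W) 1 f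
  rw [mul_one] at h
  exact ((conjFun K (1 : W ≃ₐ[k] W)).injective h).symm

variable [Fintype k] [IsAlgClosed W]

@[simp] theorem twistFun_zero_left (f : GeomFunctionField k K W) : twistFun 0 f = f := by
  rw [twistFun, zpow_zero, conjFun_one]

theorem twistFun_twistFun (m n : ℤ) (f : GeomFunctionField k K W) :
    twistFun m (twistFun n f) = twistFun (m + n) f := by
  rw [twistFun, twistFun, twistFun, zpow_add, conjFun_mul]

theorem Place.twist_ord_twistFun (n : ℤ) (x : Place W (GeomFunctionField k K W))
    (f : GeomFunctionField k K W) : (x.twist n).ord (twistFun n f) = x.ord f :=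
  x.conj_ord_conjFun _ f

theorem Place.twist_ord (n : ℤ) (x : Place W (GeomFunctionField k K W))
    (f : GeomFunctionField k K W) : (x.twist n).ord f = x.ord (twistFun (-n) f) := by
  rw [← x.twist_ord_twistFun n, twistFun_twistFun, add_neg_cancel, twistFun_zero_left]

theorem Place.twist_twist (m n : ℤ) (x : Place W (GeomFunctionField k K W)) :
    (x.twist n).twist m = x.twist (m + n) := by
  refine Place.ext_ord (AddValuation.ext fun f => ?_)
  rw [twist_ord, twist_ord, twist_ord, twistFun_twistFun, neg_add_rev]

@[simp] theorem Place.twist_zero (x : Place W (GeomFunctionField k K W)) : x.twist 0 = x := by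
  refine Place.ext_ord (AddValuation.ext fun f => ?_)
  rw [twist_ord, neg_zero, twistFun_zero_left]

theorem Place.twist_injective (n : ℤ) :
    Function.Injective (Place.twist n : Place W (GeomFunctionField k K W) → _) :=
  Function.LeftInverse.injective (g := Place.twist (-n)) fun x => by
    rw [twist_twist, neg_add_cancel, twist_zero]

theorem Place.twist_surjective (n : ℤ) :
    Function.Surjective (Place.twist n : Place W (GeomFunctionField k K W) → _) := fun x =>
  ⟨x.twist (-n), by rw [twist_twist, add_neg_cancel, twist_zero]⟩

theorem twistDiv_apply_twist (n : ℤ) (E : Divisor W (GeomFunctionField k K W))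
    (x : Place W (GeomFunctionField k K W)) : twistDiv n E (x.twist n) = E x :=
  Finsupp.mapDomain_apply (Place.twist_injective n) E x

theorem twistDiv_add (n : ℤ) (A B : Divisor W (GeomFunctionField k K W)) :
    twistDiv n (A + B) = twistDiv n A + twistDiv n B :=
  Finsupp.mapDomain_add

theorem twistDiv_sub (n : ℤ) (A B : Divisor W (GeomFunctionField k K W)) :
    twistDiv n (A - B) = twistDiv n A - twistDiv n B := by
  rw [eq_sub_iff_add_eq, ← twistDiv_add, sub_add_cancel]

theorem twistDiv_zero (n : ℤ) : twistDiv n (0 : Divisor W (GeomFunctionField k K W)) = 0 :=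
  Finsupp.mapDomain_zero

theorem twistDiv_single (n : ℤ) (x : Place W (GeomFunctionField k K W)) (m : ℤ) :
    twistDiv n (Finsupp.single x m) = Finsupp.single (x.twist n) m :=
  Finsupp.mapDomain_single

theorem twistDiv_sum {ι : Type*} (n : ℤ) (s : Finset ι)
    (A : ι → Divisor W (GeomFunctionField k K W)) :
    twistDiv n (∑ i ∈ s, A i) = ∑ i ∈ s, twistDiv n (A i) :=
  Finsupp.mapDomain_finsetSum

/-- Functions on `X` are invariant under twists, so twisting permutes the points over `x`. -/
theorem ramIdx_twist (n : ℤ) (y : Place W (GeomFunctionField k K W)) (x : Place k K) :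
    ramIdx (y.twist n) x = ramIdx y x := by
  classical
  have h : ∀ u v : K → WithTop ℤ, u = v →
      (if h : ∃ e : ℕ, 0 < e ∧ ∀ f : K, u f = e • x.ord f then h.choose else 0) =
        if h : ∃ e : ℕ, 0 < e ∧ ∀ f : K, v f = e • x.ord f then h.choose else 0 := by
    rintro u _ rfl; rfl
  unfold ramIdx
  convert! h (fun f => (y.twist n).ord (toGeom k K W f)) (fun f => y.ord (toGeom k K W f))
    (funext fun f => by rw [Place.twist_ord, twistFun_toGeom])

theorem pullback_twist (D : Divisor k K) (n : ℤ) (y : Place W (GeomFunctionField k K W)) :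
    pullback W D (y.twist n) = pullback W D y := by
  simp only [pullback, ramIdx_twist]

end Twist

section Pullback

variable {k K W : Type*} [Field k] [Field K] [Algebra k K] [Field W] [Algebra k W]
  [IsDomain (W ⊗[k] K)]

theorem ramIdx_spec {y : Place W (GeomFunctionField k K W)} {x : Place k K} (h : ramIdx y x ≠ 0) :
    ∀ f : K, y.ord (toGeom k K W f) = ramIdx y x • x.ord f := by
  unfold ramIdx at h ⊢
  split_ifs at h ⊢ with hx
  · exact hx.choose_spec.2
  · exact absurd rfl h

theorem pullback_nonneg {D : Divisor k K} (hD : 0 ≤ D) : 0 ≤ pullback W D := fun _ =>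
  Finset.sum_nonneg fun x _ => mul_nonneg (Nat.cast_nonneg _) (hD x)

variable [IsFunctionFieldOne W (GeomFunctionField k K W)]

/-- The points over `x` are among the zeros of a uniformizer at `x`. -/
theorem finite_ramIdx_ne_zero (x : Place k K) :
    {y : Place W (GeomFunctionField k K W) | ramIdx y x ≠ 0}.Finite := by
  obtain ⟨t, ht⟩ := x.exists_uniformizer
  refine (Place.finite_zeros (toGeom k K W t)).subset fun y hy => ?_
  rw [Set.mem_ofPred_eq] at hy ⊢
  have h : y.ord (toGeom k K W t) = ((ramIdx y x : ℤ) : WithTop ℤ) := by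
    rw [ramIdx_spec hy, ht, nsmul_one]; rfl
  rw [y.val_eq_of_ord_eq h]
  exact_mod_cast Nat.pos_of_ne_zero hy

/-- The divisor of `X_W` whose multiplicities are given by `pullback W D`. -/
def pullbackDivisor (W : Type*) [Field W] [Algebra k W] [IsDomain (W ⊗[k] K)]
    [IsFunctionFieldOne W (GeomFunctionField k K W)] (D : Divisor k K) :
    Divisor W (GeomFunctionField k K W) :=
  Finsupp.ofSupportFinite (pullback W D) <| by
    refine (D.support.finite_toSet.biUnion fun x _ => finite_ramIdx_ne_zero (W := W) x).subset
      fun y hy => ?_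
    obtain ⟨x, hx, h⟩ := Finset.exists_ne_zero_of_sum_ne_zero hy
    exact Set.mem_biUnion hx fun h' => h (by simp [h'])

theorem coe_pullbackDivisor (D : Divisor k K) : ⇑(pullbackDivisor W D) = pullback W D := rfl

theorem twistDiv_pullbackDivisor [Fintype k] [IsAlgClosed W] (D : Divisor k K) (n : ℤ) :
    twistDiv n (pullbackDivisor W D) = pullbackDivisor W D := by
  ext x
  obtain ⟨x, rfl⟩ := Place.twist_surjective n x
  rw [twistDiv_apply_twist, coe_pullbackDivisor, pullback_twist]

end Pullback

/-! ### Vanishing of `H⁰(O(E))` for a nondegenerate shtuka -/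

section Frobenius

variable {k K W : Type*} [Field k] [Fintype k] [Field K] [Algebra k K] [Field W] [Algebra k W]
  [IsAlgClosed W]

theorem twistFun_ne_zero (n : ℤ) {φ : GeomFunctionField k K W} (hφ : φ ≠ 0) : twistFun n φ ≠ 0 :=
  (map_ne_zero_iff _ (conjFun K (frob k W ^ n)).injective).mpr hφ

variable [IsDomain (W ⊗[k] K)]

/-- The Frobenius-semilinear map `φ ↦ φ⁽¹⁾ / f` on the function field of `X_W`. -/
def frobDiv (f : GeomFunctionField k K W) : GeomFunctionField k K W →+ GeomFunctionField k K W :=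
  (AddMonoidHom.mulLeft f⁻¹).comp (conjFun K (frob k W ^ (1 : ℤ)) : _ →+ _)

theorem frobDiv_apply (f φ : GeomFunctionField k K W) : frobDiv f φ = f⁻¹ * twistFun 1 φ := rfl

theorem frobDiv_smul (f : GeomFunctionField k K W) (c : W) (φ : GeomFunctionField k K W) :
    frobDiv f (c • φ) = c ^ Fintype.card k • frobDiv f φ := by
  rw [frobDiv_apply, frobDiv_apply, twistFun_smul, mul_smul_comm]

theorem frobDiv_injective {f : GeomFunctionField k K W} (hf : f ≠ 0) :
    Function.Injective (frobDiv f) :=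
  (mul_right_injective₀ (inv_ne_zero hf)).comp (conjFun K (frob k W ^ (1 : ℤ))).injective

/-- A finite-dimensional space stable under `φ ↦ φ⁽¹⁾ / f` is zero as soon as it contains no nonzero
fixed function: by Lang's theorem it is spanned by the fixed functions. -/
theorem eq_bot_of_frobDiv_fixed {f : GeomFunctionField k K W} (hf : f ≠ 0)
    (U : Submodule W (GeomFunctionField k K W)) [Module.Finite W U]
    (hU : ∀ v ∈ U, frobDiv f v ∈ U) (h : ∀ v ∈ U, frobDiv f v = v → v = 0) : U = ⊥ := by
  let φ : U →+ U := AddMonoidHom.mk' (fun v => ⟨frobDiv f v, hU v v.2⟩) fun v w =>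
    Subtype.ext (map_add _ _ _)
  have hspan := span_fixed_eq_top (W := W) (Fintype.one_lt_card (α := k)) φ
    (fun c v => Subtype.ext (frobDiv_smul f c v))
    (fun v w hvw => Subtype.ext (frobDiv_injective hf (congrArg Subtype.val hvw)))
  have hfix : {v : U | φ v = v} ⊆ {0} := fun v hv =>
    Subtype.ext (h v v.2 (congrArg Subtype.val hv))
  rw [eq_bot_iff]
  intro v hv
  have : (⟨v, hv⟩ : U) ∈ Submodule.span W {v : U | φ v = v} := hspan ▸ Submodule.mem_top
  have h0 : (⟨v, hv⟩ : U) = 0 :=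
    (Submodule.mem_bot W).mp
      (Submodule.span_zero_singleton W (M := U) ▸ Submodule.span_mono hfix this)
  exact congrArg Subtype.val h0

/-- A pole allowed at `x` and a zero imposed at `y ≠ x` do not interact. -/
theorem mem_H0_sub_single {F L : Type*} [Field F] [Field L] [Algebra F L] {A : Divisor F L}
    {x y : Place F L} {φ : L} (hA : φ ∈ H0 ⇑A)
    (h : φ ∈ H0 (A + Finsupp.single x 1 - Finsupp.single y 1 : Divisor F L)) (hyx : y ≠ x) :
    φ ∈ H0 (A - Finsupp.single y 1 : Divisor F L) := by
  classical
  intro z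
  by_cases hz : z = x
  · subst hz
    have := hA z
    rwa [Finsupp.sub_apply, Finsupp.single_eq_of_ne hyx.symm, sub_zero]
  · have := h z
    rwa [Finsupp.sub_apply, Finsupp.add_apply, Finsupp.single_eq_of_ne hz, add_zero,
      ← Finsupp.sub_apply] at this

section

variable {f : GeomFunctionField k K W} {ξ η : Place W (GeomFunctionField k K W)}
  {E : Divisor W (GeomFunctionField k K W)} (hf : f ≠ 0)
  (hord : ∀ x : Place W (GeomFunctionField k K W), x.ord f = (((E - twistDiv 1 E -
    (-Finsupp.single (ξ.twist 1) 1 + Finsupp.single η 1) : Divisor W (GeomFunctionField k K W)) x :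
      ℤ) : WithTop ℤ))

include hf hord

/-- If `(f) = E - E⁽¹⁾ + ξ⁽¹⁾ - η`, the map `φ ↦ φ⁽¹⁾ / f` carries `O(E + G)` to
`O(E + G⁽¹⁾ + ξ⁽¹⁾ - η)`. -/
theorem frobDiv_mem_H0_iff (G : Divisor W (GeomFunctionField k K W))
    (φ : GeomFunctionField k K W) :
    frobDiv f φ ∈ H0 (E + (twistDiv 1 G + Finsupp.single (ξ.twist 1) 1) - Finsupp.single η 1 :
      Divisor W (GeomFunctionField k K W)) ↔
    φ ∈ H0 (E + G : Divisor W (GeomFunctionField k K W)) := by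
  by_cases hφ : φ = 0
  · subst hφ
    rw [map_zero]
    exact iff_of_true (zero_mem _) (zero_mem _)
  have ht := twistFun_ne_zero 1 hφ
  rw [mem_H0_iff_val hφ, frobDiv_apply, mem_H0_iff_val (mul_ne_zero (inv_ne_zero hf) ht),
    (Place.twist_surjective 1).forall]
  refine forall_congr' fun x => ?_
  have h1 : (x.twist 1).val (twistFun 1 φ) = x.val φ :=
    (x.twist 1).val_eq_of_ord_eq (by rw [x.twist_ord_twistFun, x.coe_val hφ])
  have h2 := (x.twist 1).val_eq_of_ord_eq (hord (x.twist 1))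
  rw [Place.val_mul _ (inv_ne_zero hf) ht, Place.val_inv, h1, h2]
  simp only [Finsupp.sub_apply, Finsupp.add_apply, Finsupp.neg_apply, twistDiv_apply_twist]
  constructor <;> intro h <;> linarith

variable [IsFunctionFieldOne W (GeomFunctionField k K W)]

/-- A function `v = v⁽¹⁾ / f` with a zero forced at `η` also has zeros forced at `η⁽¹⁾`, `η⁽²⁾`, …,
as long as these points differ from the pole `ξ⁽¹⁾`; eventually the degree leaves no room. -/
theorem eq_zero_of_frobDiv_fixed {G : Divisor W (GeomFunctionField k K W)} (hG : twistDiv 1 G = G)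
    (hη : ∀ i : ℤ, 1 - deg ⇑(E + G) ≤ i → i ≤ 0 → η ≠ ξ.twist i)
    {v : GeomFunctionField k K W} (hv : frobDiv f v = v)
    (hvη : v ∈ H0 (E + G - Finsupp.single η 1 : Divisor W (GeomFunctionField k K W))) : v = 0 := by
  have key : ∀ j : ℕ, (j : ℤ) ≤ max 0 (deg ⇑(E + G)) →
      v ∈ H0 (E + (G - ∑ i ∈ Finset.range (j + 1), Finsupp.single (η.twist i) 1) :
        Divisor W (GeomFunctionField k K W)) := by
    intro j
    induction j with
    | zero =>
      intro _
      simpa [add_sub_assoc] using hvη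
    | succ j ih =>
      intro hj
      have hvj := ih (by rw [Nat.cast_succ] at hj; omega)
      have h := (frobDiv_mem_H0_iff hf hord _ v).mpr hvj
      have e : twistDiv 1 (G - ∑ i ∈ Finset.range (j + 1), Finsupp.single (η.twist i) (1 : ℤ)) =
          G - ∑ i ∈ Finset.range (j + 1), Finsupp.single (η.twist (i + 1 : ℕ)) 1 := by
        rw [twistDiv_sub, hG, twistDiv_sum]
        congr 1
        refine Finset.sum_congr rfl fun i _ => ?_
        rw [twistDiv_single, Place.twist_twist]
        push_cast
        rw [add_comm]
      rw [hv, e] at h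
      rw [Finset.sum_range_succ, ← sub_sub, ← add_sub_assoc]
      refine mem_H0_sub_single (x := ξ.twist 1) hvj ?_ fun hjξ => ?_
      · convert! h using 3
        rw [Finset.sum_range_succ' (fun i => Finsupp.single (η.twist i) (1 : ℤ)) j,
          Finset.sum_range_succ (fun i => Finsupp.single (η.twist (i + 1 : ℕ)) (1 : ℤ)) j,
          Nat.cast_zero, Place.twist_zero]
        abel
      · refine hη (-(j : ℤ)) (by rw [Nat.cast_succ] at hj; omega) (by omega) ?_
        refine Place.twist_injective ((j : ℤ) + 1) ?_
        rw [Place.twist_twist]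
        push_cast at hjξ
        rw [hjξ]
        congr 1
        ring
  have := key (deg ⇑(E + G)).toNat (by omega)
  rw [H0_eq_bot_of_deg_neg] at this
  · exact (Submodule.mem_bot _).mp this
  · have hs : ∀ n : ℕ, deg ⇑(∑ i ∈ Finset.range n, Finsupp.single (η.twist i) (1 : ℤ)) = n := by
      intro n
      induction n with
      | zero => simp
      | succ n ih => rw [Finset.sum_range_succ, deg_coe_add, ih, deg_single]; push_cast; ring
    rw [← add_sub_assoc, deg_coe_sub, hs]
    push_cast
    omega

/-- The space `H⁰(O(E))` vanishes: otherwise the spaces `H⁰(O(E + ξ⁽¹⁾ + … + ξ⁽ᵐ⁾))` grow strictly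
up to `m = g`, where the degree is `2 g - 1` and the dimension is only `g`. -/
theorem H0_eq_bot_of_shtuka (hdeg : deg ⇑E = (genus W (GeomFunctionField k K W) : ℤ) - 1)
    (hη : ∀ i : ℤ, 1 - deg ⇑E ≤ i → i ≤ (genus W (GeomFunctionField k K W) : ℤ) →
      η ≠ ξ.twist i) : H0 ⇑E = ⊥ := by
  have : Nonempty (Place W (GeomFunctionField k K W)) := ⟨ξ⟩
  set g := genus W (GeomFunctionField k K W) with hg
  by_contra hne
  have hg1 : 1 ≤ g := by
    by_contra h
    exact hne (H0_eq_bot_of_deg_neg (by omega))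
  let S : ℕ → Divisor W (GeomFunctionField k K W) := fun m =>
    ∑ i ∈ Finset.range m, Finsupp.single (ξ.twist (i + 1 : ℕ)) 1
  have hS0 : E + S 0 = E := by simp [S]
  have hSsucc : ∀ m, S (m + 1) = S m + Finsupp.single (ξ.twist (m + 1 : ℕ)) 1 := fun m =>
    Finset.sum_range_succ _ _
  have hStwist : ∀ m, twistDiv 1 (S m) + Finsupp.single (ξ.twist 1) 1 = S (m + 1) := by
    intro m
    simp only [S]
    rw [Finset.sum_range_succ', twistDiv_sum]
    congr 1
    refine Finset.sum_congr rfl fun i _ => ?_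
    rw [twistDiv_single, Place.twist_twist]
    push_cast
    congr 2
    ring
  have hmono : ∀ m, H0 ⇑(E + S m) ≤ H0 ⇑(E + S (m + 1)) := fun m => by
    rw [hSsucc, ← add_assoc]
    exact H0_mono (le_add_of_nonneg_right (Finsupp.single_nonneg.mpr zero_le_one) :
      E + S m ≤ E + S m + Finsupp.single _ 1)
  have hT : ∀ m φ, frobDiv f φ ∈ H0 (E + S (m + 1) - Finsupp.single η 1 :
      Divisor W (GeomFunctionField k K W)) ↔ φ ∈ H0 ⇑(E + S m) := fun m φ => by
    rw [← hStwist, frobDiv_mem_H0_iff hf hord]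
  have hsub : ∀ A : Divisor W (GeomFunctionField k K W),
      H0 (A - Finsupp.single η 1 : Divisor W (GeomFunctionField k K W)) ≤ H0 ⇑A := fun A =>
    H0_mono (sub_le_self _ (Finsupp.single_nonneg.mpr zero_le_one) : A - Finsupp.single η 1 ≤ A)
  -- if `H⁰(O(E + S (m + 1)))` is no larger than `H⁰(O(E + S m))`, the functions `φ⁽¹⁾ / f` with `φ`
  -- in the latter vanish at `η` to the order imposed by `E + S m - η`
  have hstab : ∀ m : ℕ, m + 1 ≤ g → H0 ⇑(E + S (m + 1)) ≤ H0 ⇑(E + S m) → ∀ φ ∈ H0 ⇑(E + S m),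
      frobDiv f φ ∈ H0 (E + S m - Finsupp.single η 1 : Divisor W (GeomFunctionField k K W)) := by
    intro m hm h φ hφ
    have h1 := (hT m φ).mpr hφ
    refine mem_H0_sub_single (x := ξ.twist (m + 1 : ℕ)) (h (hsub _ h1)) ?_
      (hη _ (by push_cast; omega) (by push_cast; omega))
    rwa [hSsucc, ← add_assoc] at h1
  have hstep : ∀ m : ℕ, m + 1 ≤ g → ¬ H0 ⇑(E + S (m + 1)) ≤ H0 ⇑(E + S m) := by
    intro m
    induction m with
    | zero =>
      intro hm h
      have hstab0 := hstab 0 hm h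
      rw [hS0] at hstab0
      refine hne (eq_bot_of_frobDiv_fixed hf _ (fun v hv => hsub _ (hstab0 v hv))
        fun v hv hvf => ?_)
      refine eq_zero_of_frobDiv_fixed hf hord (G := 0) (twistDiv_zero 1) ?_ hvf ?_
      · rw [add_zero]
        exact fun i hi hi0 => hη i hi (by omega)
      · rw [add_zero, ← hvf]
        exact hstab0 v hv
    | succ m ih =>
      intro hm h
      -- a failure of strict growth propagates downwards, as `φ⁽¹⁾ / f` lies in
      -- `H⁰(O(E + S (m + 1) - η))` only for `φ` in `H⁰(O(E + S m))`
      refine ih (by omega) fun φ hφ => (hT m φ).mp (hstab (m + 1) hm h φ hφ)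
  have hdim : ∀ m : ℕ, m ≤ g →
      Module.finrank W (H0 ⇑E) + m ≤ Module.finrank W (H0 ⇑(E + S m)) := by
    intro m
    induction m with
    | zero => rw [hS0]; simp
    | succ m ih =>
      intro hm
      have := Submodule.finrank_lt_finrank_of_lt
        (lt_of_le_not_ge (hmono m) (hstep m hm))
      have := ih (by omega)
      omega
  have hdegS : ∀ m, deg ⇑(S m) = m := by
    intro m
    induction m with
    | zero => simp [S]
    | succ m ih => rw [hSsucc, deg_coe_add, ih, deg_single]; push_cast; ring
  have hd : deg ⇑(E + S g) = 2 * (g : ℤ) - 1 := by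
    rw [deg_coe_add, hdegS, hdeg]; ring
  have hRR := finrank_H0_sub_finrank_H1 (E + S g)
  rw [finrank_H1_eq_zero hd.ge, hd, ← hg] at hRR
  have := hdim g le_rfl
  rw [Nat.cast_zero] at hRR
  exact hne (Submodule.finrank_eq_zero.mp (by omega))

end

end Frobenius

/-! ### The space `Ψ` -/

section Shtuka

variable {k K W : Type*} [Field k] [Field K] [Algebra k K] [Field W] [Algebra k W]
  [IsDomain (W ⊗[k] K)] {D : Divisor k K} {E : Divisor W (GeomFunctionField k K W)}

theorem neg_pullback_le_ord (hE : ∀ x, pullback W D x ≠ 0 → E x = 0)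
    {ψ : GeomFunctionField k K W} (hψ : ψ ∈ H0 (⇑E + pullback W D))
    {x : Place W (GeomFunctionField k K W)} (hx : pullback W D x ≠ 0) :
    ((-pullback W D x : ℤ) : WithTop ℤ) ≤ x.ord ψ := by
  have := hψ x
  rwa [Pi.add_apply, hE x hx, zero_add] at this

theorem mem_H0_of_regular (hE : ∀ x, pullback W D x ≠ 0 → E x = 0)
    {ψ : GeomFunctionField k K W} (hψ : ψ ∈ H0 (⇑E + pullback W D))
    (h : ∀ x, pullback W D x ≠ 0 → 0 ≤ x.ord ψ) : ψ ∈ H0 ⇑E := fun x => by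
  by_cases hx : pullback W D x = 0
  · have := hψ x
    rwa [Pi.add_apply, hx, add_zero] at this
  · rw [hE x hx]
    exact h x hx

variable [Fintype k] [IsAlgClosed W]

theorem neg_pullback_le_ord_twistFun (hE : ∀ x, pullback W D x ≠ 0 → E x = 0)
    {ψ : GeomFunctionField k K W} (hψ : ψ ∈ H0 (⇑E + pullback W D))
    {x : Place W (GeomFunctionField k K W)} (hx : pullback W D x ≠ 0) :
    ((-pullback W D x : ℤ) : WithTop ℤ) ≤ x.ord (twistFun 1 ψ) := by
  obtain ⟨y, rfl⟩ := Place.twist_surjective 1 x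
  rw [pullback_twist] at hx ⊢
  rw [Place.twist_ord_twistFun]
  exact neg_pullback_le_ord hE hψ hx

variable [IsFunctionFieldOne W (GeomFunctionField k K W)]

/-- If `H¹(O(E)) = 0`, the polar parts of `ψ⁽¹⁾` along `D` are those of a function with no other
poles than those allowed by `E`. -/
theorem exists_regular_sub_twistFun (hD : 0 ≤ D) (hE : ∀ x, pullback W D x ≠ 0 → E x = 0)
    (hH1 : boundaries E = ⊤) {ψ : GeomFunctionField k K W} (hψ : ψ ∈ H0 (⇑E + pullback W D)) :
    ∃ φ ∈ H0 (⇑E + pullback W D), ∀ x : Place W (GeomFunctionField k K W),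
      pullback W D x ≠ 0 → 0 ≤ x.ord (φ - twistFun 1 ψ) := by
  classical
  let r : repartitions W (GeomFunctionField k K W) :=
    ⟨fun x => if pullback W D x ≠ 0 then twistFun 1 ψ else 0,
      (pullbackDivisor W D).support.finite_toSet.subset fun x hx => by
        rw [Finset.mem_coe, Finsupp.mem_support_iff, coe_pullbackDivisor]
        intro h
        exact hx (by simp [h])⟩
  obtain ⟨φ, hφ⟩ := mem_boundaries_iff.mp (hH1 ▸ Submodule.mem_top : r ∈ boundaries E)
  have hreg : ∀ x : Place W (GeomFunctionField k K W), pullback W D x ≠ 0 →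
      0 ≤ x.ord (φ - twistFun 1 ψ) := fun x hx => by
    have := hφ x
    rw [hE x hx, show r.1 x = twistFun 1 ψ from if_pos hx, x.ord.map_sub_swap] at this
    exact this
  refine ⟨φ, fun x => ?_, hreg⟩
  by_cases hx : pullback W D x = 0
  · have := hφ x
    rw [show r.1 x = 0 from if_neg (not_not.mpr hx), zero_sub, x.ord.map_neg] at this
    rwa [Pi.add_apply, hx, add_zero]
  · rw [Pi.add_apply, hE x hx, zero_add, ← sub_add_cancel φ (twistFun 1 ψ)]
    refine x.ord.map_le_add (le_trans ?_ (hreg x hx)) (neg_pullback_le_ord_twistFun hE hψ hx)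
    exact_mod_cast neg_nonpos.mpr (pullback_nonneg (W := W) hD x)

/-- `Ψ ⊗ W = H⁰(O(E + D))`: taking the function whose polar parts along `D` are those of `ψ⁽¹⁾` is
an injective Frobenius-semilinear endomorphism of `H⁰(O(E + D))`, with fixed vectors `Ψ`. -/
theorem psiMulMap_injective_range (hD : 0 ≤ D) (hE : ∀ x, pullback W D x ≠ 0 → E x = 0)
    (hH0 : H0 ⇑E = ⊥) (hH1 : boundaries E = ⊤) :
    Function.Injective (psiMulMap D E) ∧
      LinearMap.range (psiMulMap D E) = H0 (⇑E + pullback W D) := by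
  set V := H0 (⇑E + pullback W D)
  have hfin : Module.Finite W V :=
    finite_H0 (E + pullbackDivisor W D : Divisor W (GeomFunctionField k K W))
  choose h hmem hreg using fun ψ : V => exists_regular_sub_twistFun hD hE hH1 ψ.2
  have huniq : ∀ (ψ : V) (a : GeomFunctionField k K W), a ∈ V →
      (∀ x : Place W (GeomFunctionField k K W), pullback W D x ≠ 0 →
        0 ≤ x.ord (a - twistFun 1 (ψ : GeomFunctionField k K W))) → h ψ = a := by
    intro ψ a ha har
    have : h ψ - a ∈ H0 ⇑E := mem_H0_of_regular hE (V.sub_mem (hmem ψ) ha) fun x hx => by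
      rw [← sub_sub_sub_cancel_right _ _ (twistFun 1 (ψ : GeomFunctionField k K W))]
      exact x.ord.map_le_sub (hreg ψ x hx) (har x hx)
    rw [hH0] at this
    exact sub_eq_zero.mp ((Submodule.mem_bot W).mp this)
  have hadd : ∀ a b : GeomFunctionField k K W, twistFun 1 (a + b) = twistFun 1 a + twistFun 1 b :=
    map_add (conjFun K (frob k W ^ (1 : ℤ)))
  let φ : V →+ V := AddMonoidHom.mk' (fun ψ => ⟨h ψ, hmem ψ⟩) fun a b =>
    Subtype.ext <| huniq _ _ (V.add_mem (hmem a) (hmem b)) fun x hx => by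
      rw [Submodule.coe_add a b, hadd, Submodule.coe_add, add_sub_add_comm]
      exact x.ord.map_le_add (hreg a x hx) (hreg b x hx)
  have hsmul : ∀ (c : W) (v : V), φ (c • v) = c ^ Fintype.card k • φ v := fun c v =>
    Subtype.ext <| huniq _ _ (V.smul_mem _ (hmem v)) fun x hx => by
      rw [Submodule.coe_smul c v, twistFun_smul, Submodule.coe_smul, ← smul_sub]
      exact x.le_ord_smul _ (hreg v x hx)
  have hinj : Function.Injective φ := (injective_iff_map_eq_zero φ).mpr fun v hv => by
    have hv0 : h v = 0 := congrArg Subtype.val hv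
    have : (v : GeomFunctionField k K W) ∈ H0 ⇑E := mem_H0_of_regular hE v.2 fun x hx => by
      have := hreg v (x.twist 1) (by rwa [pullback_twist])
      rwa [hv0, zero_sub, AddValuation.map_neg, Place.twist_ord_twistFun] at this
    rw [hH0] at this
    exact Subtype.ext ((Submodule.mem_bot W).mp this)
  have hfix : ∀ v : V, φ v = v ↔ (v : GeomFunctionField k K W) ∈ Psi D E := fun v =>
    ⟨fun hv => ⟨v.2, fun x hx => by
      have := hreg v x hx
      rwa [show h v = v from congrArg Subtype.val hv] at this⟩,
      fun hv => Subtype.ext (huniq v v v.2 hv.2)⟩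
  constructor
  · refine injective_liftBaseChange_subtype _ fun b hb hbΨ => ?_
    let b' : _ → V := fun i => ⟨b i, (hbΨ i).1⟩
    have hb' : LinearIndependent k b' :=
      LinearIndependent.of_comp (V.subtype.restrictScalars k) hb
    exact (linearIndependent_of_fixed φ hsmul hb' fun i => (hfix _).mpr (hbΨ i)).map' V.subtype
      V.ker_subtype
  · rw [psiMulMap, LinearMap.range_liftBaseChange]
    refine le_antisymm (Submodule.span_le.mpr ?_) fun v hv => ?_
    · rintro _ ⟨ψ, rfl⟩
      exact ψ.2.1
    · have hspan := span_fixed_eq_top (W := W) (Fintype.one_lt_card (α := k)) φ hsmul hinj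
      have : V.subtype ⟨v, hv⟩ ∈ (Submodule.span W {v : V | φ v = v}).map V.subtype :=
        Submodule.mem_map_of_mem (hspan ▸ Submodule.mem_top)
      rw [Submodule.map_span] at this
      refine Submodule.span_mono ?_ this
      rintro _ ⟨u, hu, rfl⟩
      exact ⟨⟨u, (hfix u).mp hu⟩, rfl⟩

/-- For `ψ ∈ Ψ` vanishing at `ξ`, the difference of `ψ` and `ψ⁽¹⁾ / f` is regular near `D`, so it
lies in `H⁰(O(E)) = 0`. Thus `ψ` is fixed by `φ ↦ φ⁽¹⁾ / f`, which forces
zeros at `η`, `η⁽¹⁾`, …. -/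
theorem Psi_inf_H0_eq_bot {ξ η : Place W (GeomFunctionField k K W)} {f : GeomFunctionField k K W}
    (hf : f ≠ 0)
    (hord : ∀ x : Place W (GeomFunctionField k K W), x.ord f = (((E - twistDiv 1 E -
      (-Finsupp.single (ξ.twist 1) 1 + Finsupp.single η 1) :
        Divisor W (GeomFunctionField k K W)) x : ℤ) : WithTop ℤ))
    (hfD : ∀ x : Place W (GeomFunctionField k K W), pullback W D x ≠ 0 →
      ((pullback W D x : ℤ) : WithTop ℤ) ≤ x.ord (f - 1))
    (hE : ∀ x, pullback W D x ≠ 0 → E x = 0) (hH0 : H0 ⇑E = ⊥)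
    (hη : ∀ i : ℤ, 1 - deg (⇑E + pullback W D) ≤ i → i ≤ 0 → η ≠ ξ.twist i)
    (hξD : pullback W D ξ = 0) (hηD : pullback W D η = 0) :
    Psi D E ⊓ (H0 (⇑E + pullback W D - ⇑(Finsupp.single ξ (1 : ℤ)))).restrictScalars k = ⊥ := by
  classical
  rw [eq_bot_iff]
  rintro ψ ⟨hψ, hψξ⟩
  set P := pullbackDivisor W D
  have hψξ' : ψ ∈ H0 (E + (P - Finsupp.single ξ 1) : Divisor W (GeomFunctionField k K W)) := by
    rw [← add_sub_assoc]; exact hψξ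
  -- the pole of `f⁻¹` at `ξ⁽¹⁾` is cancelled by the zero of `ψ⁽¹⁾` there
  have hT := (frobDiv_mem_H0_iff hf hord _ ψ).mpr hψξ'
  rw [twistDiv_sub, twistDiv_pullbackDivisor, twistDiv_single, sub_add_cancel] at hT
  have hle : H0 (E + P - Finsupp.single η 1 : Divisor W (GeomFunctionField k K W)) ≤
      H0 (⇑E + pullback W D) :=
    H0_mono (sub_le_self _ (Finsupp.single_nonneg.mpr zero_le_one) :
      E + P - Finsupp.single η 1 ≤ E + P)
  have hfix : frobDiv f ψ = ψ := by
    have : ψ - frobDiv f ψ ∈ H0 ⇑E :=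
      mem_H0_of_regular hE (Submodule.sub_mem _ hψ.1 (hle hT)) fun x hx => by
        have hne : ∀ z : Place W (GeomFunctionField k K W), pullback W D z = 0 → x ≠ z := by
          rintro z hz rfl; exact hx hz
        have hE1 : twistDiv 1 E x = 0 := by
          obtain ⟨y, rfl⟩ := Place.twist_surjective 1 x
          rw [twistDiv_apply_twist]
          exact hE y (by rwa [pullback_twist] at hx)
        have hf0 : x.val f = 0 := x.val_eq_of_ord_eq (by
          rw [hord x, Finsupp.sub_apply, Finsupp.sub_apply, Finsupp.add_apply, Finsupp.neg_apply,
            hE x hx, hE1, Finsupp.single_eq_of_ne (hne _ (by rw [pullback_twist, hξD])),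
            Finsupp.single_eq_of_ne (hne _ hηD)]
          simp)
        have hinv : x.ord f⁻¹ = 0 := by
          rw [← x.coe_val (inv_ne_zero hf), x.val_inv, hf0]; rfl
        have e : ψ - frobDiv f ψ =
            (ψ - twistFun 1 ψ) + f⁻¹ * ((f - 1) * twistFun 1 ψ) := by
          rw [frobDiv_apply]
          field_simp
          ring
        rw [e]
        refine x.ord.map_le_add (hψ.2 x hx) ?_
        rw [x.ord.map_mul, hinv, zero_add]
        have := x.ord_mul_le (hfD x hx) (neg_pullback_le_ord_twistFun hE hψ.1 hx)
        simpa using this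
    rw [hH0] at this
    exact (sub_eq_zero.mp ((Submodule.mem_bot W).mp this)).symm
  rw [hfix] at hT
  exact eq_zero_of_frobDiv_fixed hf hord (twistDiv_pullbackDivisor D 1) hη hfix hT

end Shtuka

end

theorem theorem5p1 {k K W : Type*}
    -- `k` is the field with `q` elements, `K` the function field of the curve `X` over `k`
    [Field k] [Fintype k] [Field K] [Algebra k K]
    [Algebra.EssFiniteType k K] (_hK : Algebra.trdeg k K = 1)
    -- `W` is an algebraically closed field over `k`; `X` is geometrically connected
    [Field W] [Algebra k W] [IsAlgClosed W] [IsDomain (W ⊗[k] K)]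
    (D : Divisor k K) (ξ η : Place W (GeomFunctionField k K W))
    (E : Divisor W (GeomFunctionField k K W))
    (_hS : IsShtuka D ξ η E) (_hN : IsNondegenerate D ξ η E) :
    (h0 E = 0 ∧ h1 E = 0) ∧
    (Function.Injective (psiMulMap D E) ∧
      LinearMap.range (psiMulMap D E) = H0 (⇑E + pullback W D)) ∧
    Psi D E ⊓ (H0 (⇑E + pullback W D - ⇑(Finsupp.single ξ (1 : ℤ)))).restrictScalars k = ⊥ := by
  have : IsFunctionFieldOne W (GeomFunctionField k K W) := isFunctionFieldOne_geomFunctionField _hK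
  have : Nonempty (Place W (GeomFunctionField k K W)) := ⟨ξ⟩
  obtain ⟨hD, -, hξD, hηD, hE, ⟨f, hf, hord, hfD⟩, hdeg⟩ := _hS
  have hdegD : 0 ≤ deg (pullback W D) := deg_nonneg (A := pullbackDivisor W D) (pullback_nonneg hD)
  have hdegED : deg (⇑E + pullback W D) = deg ⇑E + deg (pullback W D) :=
    deg_coe_add E (pullbackDivisor W D)
  have hH0 : H0 ⇑E = ⊥ := H0_eq_bot_of_shtuka hf hord hdeg fun i hi hig => _hN i (by omega) hig
  have hRR := finrank_H0_sub_finrank_H1 E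
  rw [hH0, finrank_bot, hdeg] at hRR
  have hH1 : Subsingleton (H1 E) := (Module.finrank_zero_iff (R := W)).mp (by omega)
  refine ⟨⟨?_, rank_subsingleton' W (H1 E)⟩,
    psiMulMap_injective_range hD hE hH0 (Submodule.Quotient.subsingleton_iff.mp hH1), ?_⟩
  · rw [h0, hH0]
    exact rank_bot W _
  · exact Psi_inf_H0_eq_bot hf hord hfD hE hH0 (fun i hi hi0 => _hN i hi (by omega)) hξD hηD
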